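/- **Setting.** Let $(V,\eta)$ be a four-dimensional real vector space with an inner product of signature $(+,-,-,-)$, $C\ell(V)$ its Clifford algebra with $v^2=-\eta(v,v)$, $S$ an irreducible $C\ell(V)$-module and $\langle-,-\rangle$ a symplectic form on $S$ with $\langle v\cdot s,t\rangle=-\langle s,v\cdot t\rangle$. Let $\sigma$ be the spinor representation of $\mathfrak{so}(V)$ on $S$, i.e. $\sigma(v\wedge w)s=\tfrac14(v\cdot w-w\cdot v)\cdot s$ where $(v\wedge w)(u)=\eta(u,v)w-\eta(u,w)v$, and let $\kappa:S\times S\to V$ be the symmetric bilinear map with $\eta(\kappa(s,t),v)=\langle s,v\cdot t\rangle$. The Poincaré superalgebra is $\mathfrak p=V\oplus S\oplus\mathfrak{so}(V)$, with even part $V\oplus\mathfrak{so}(V)$, odd part $S$, summands of degree $-2,-1,0$, and nonzero brackets $[A,B]=AB-BA$, $[A,s]=\sigma(A)s$, $[A,v]=Av$, $[s,t]=\kappa(s,t)$. Let $\mathfrak a=V\oplus S\oplus\mathfrak h$ be a $\mathbb Z$-graded subalgebra of $\mathfrak p$ that differs from $\mathfrak p$ at most in degree $0$, and $\mathfrak a_-=V\oplus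 S$. Let $C^{d,1}(\mathfrak a_-,\mathfrak a)$ be the space of linear maps $\mathfrak a_-\to\mathfrak a$ of degree $d$ and $C^{d,2}(\mathfrak a_-,\mathfrak a)$ the space of bilinear maps $\zeta:\mathfrak a_-\times\mathfrak a_-\to\mathfrak a$ of degree $d$ with $\zeta(X,Y)=-(-1)^{xy}\zeta(Y,X)$ for $X,Y$ homogeneous of parities $x,y$. For even $d$ the Spencer differential $\partial$ (the Chevalley–Eilenberg differential of $\mathfrak a_-$ with values in $\mathfrak a$) is $$\partial\psi(X,Y)=[X,\psi(Y)]-(-1)^{xy}[Y,\psi(X)]-\psi([X,Y]),$$ $$\begin{aligned}\partial\zeta(X,Y,Z)={}&[X,\zeta(Y,Z)]+(-1)^{x(y+z)}[Y,\zeta(Z,X)]+(-1)^{z(x+y)}[Z,\zeta(X,Y)]\\&-\zeta([X,Y],Z)-(-1)^{x(y+z)}\zeta([Y,Z],X)-(-1)^{z(x+y)}\zeta([Z,X],Y),\end{aligned}$$ and $H^{2,2}(\mathfrak a_-,\mathfrak a)=\ker\partial|_{C^{2,2}}/\partial C^{2,1}$, an $\mathfrak h$-module under $(A\cdot\zeta)(X,Y)=[A,\zeta(X,Y)]-\zeta([A,X],Y)-\zeta(X,[A,Y])$.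 A filtered Lie superalgebra is a real Lie superalgebra $\mathfrak g$ with a decreasing filtration $(\mathfrak g^i)_{i\in\mathbb Z}$ by $\mathbb Z/2$-graded subspaces such that $\bigcup_i\mathfrak g^i=\mathfrak g$, $\bigcap_i\mathfrak g^i=0$ and $[\mathfrak g^i,\mathfrak g^j]\subset\mathfrak g^{i+j}$. A filtered deformation of $\mathfrak a$ is a filtered Lie superalgebra $\mathfrak g$ together with an isomorphism $\varphi$ of graded Lie superalgebras from its associated graded superalgebra $\bigoplus_i\mathfrak g^i/\mathfrak g^{i+1}$ to $\mathfrak a$. An adapted identification is an even linear isomorphism $\Theta:\mathfrak a\to\mathfrak g$ that maps $\mathfrak a_i$ into $\mathfrak g^i$ and induces $\varphi^{-1}$ on the associated graded spaces. Through $\Theta$ the bracket of $\mathfrak g$ becomes a bilinear map on $\mathfrak a$; let $\mu_\Theta$ be its component of degree $2$. **Proposition.** Let $\mathfrak g$ be a filtered deformation of $\mathfrak a$. Adapted identifications of $\mathfrak g$ exist, and: 1. for every adapted identification $\Theta$ the map $\mu_\Theta|_{\mathfrak a_-\otimes\mathfrak a_-}$ is a cocycle in $C^{2,2}(\mathfrak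 a_-,\mathfrak a)$, and its class $[\mu_\Theta|_{\mathfrak a_-\otimes\mathfrak a_-}]\in H^{2,2}(\mathfrak a_-,\mathfrak a)$ is $\mathfrak h$-invariant; 2. if $\mathfrak g'$ is another filtered deformation of $\mathfrak a$, and $[\mu'_{\Theta'}|_{\mathfrak a_-\otimes\mathfrak a_-}]=[\mu_\Theta|_{\mathfrak a_-\otimes\mathfrak a_-}]$ for some adapted identifications $\Theta$ of $\mathfrak g$ and $\Theta'$ of $\mathfrak g'$, then $\mathfrak g'$ and $\mathfrak g$ are isomorphic as filtered Lie superalgebras. -/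

import Mathlib

open DirectSum

set_option maxSynthPendingDepth 3

noncomputable section

/-! ### Lie superalgebras, gradings and filtrations -/

/-- The sign `(-1)^(i j)` attached to two parities. -/
def superSign (i j : ZMod 2) : ℝ := (-1) ^ (i.val * j.val)

/-- A real Lie superalgebra structure on the vector space `L`. -/
structure LieSuperalgebra (L : Type*) [AddCommGroup L] [Module ℝ L] where
  /-- the even part `part 0` and the odd part `part 1` -/
  part : ZMod 2 → Submodule ℝ L
  part_internal : DirectSum.IsInternal part
  bracket : L →ₗ[ℝ] L →ₗ[ℝ] L
  bracket_mem : ∀ {i j : ZMod 2} {x y : L}, x ∈ part i → y ∈ part j →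
    bracket x y ∈ part (i + j)
  skew : ∀ {i j : ZMod 2} {x y : L}, x ∈ part i → y ∈ part j →
    bracket x y = -(superSign i j • bracket y x)
  jacobi : ∀ {i j k : ZMod 2} {x y z : L}, x ∈ part i → y ∈ part j → z ∈ part k →
    bracket x (bracket y z) = bracket (bracket x y) z + superSign i j • bracket y (bracket x z)

/-- A `ℤ`-graded Lie superalgebra in which the parity is the degree modulo `2`. -/
structure GradedLieSuperalgebra (L : Type*) [AddCommGroup L] [Module ℝ L] extends
    LieSuperalgebra L where
  deg : ℤ → Submodule ℝ L
  deg_internal : DirectSum.IsInternal deg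
  deg_bracket_mem : ∀ {i j : ℤ} {x y : L}, x ∈ deg i → y ∈ deg j →
    bracket x y ∈ deg (i + j)
  deg_le_part : ∀ i : ℤ, deg i ≤ part (i : ZMod 2)

/-- A filtered Lie superalgebra: a decreasing, exhaustive and separated filtration by
`ℤ/2`-graded subspaces, compatible with the bracket. -/
structure FilteredLieSuperalgebra (L : Type*) [AddCommGroup L] [Module ℝ L] extends
    LieSuperalgebra L where
  filt : ℤ → Submodule ℝ L
  filt_antitone : Antitone filt
  filt_exhaustive : ∀ x : L, ∃ i, x ∈ filt i
  filt_separated : ∀ x : L, (∀ i, x ∈ filt i) → x = 0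
  filt_homogeneous : ∀ i, filt i = ⨆ e : ZMod 2, filt i ⊓ part e
  filt_bracket_mem : ∀ {i j : ℤ} {x y : L}, x ∈ filt i → y ∈ filt j →
    bracket x y ∈ filt (i + j)

/-- Isomorphisms of filtered Lie superalgebras. -/
structure FilteredIso {L M : Type*} [AddCommGroup L] [Module ℝ L] [AddCommGroup M] [Module ℝ M]
    (g : FilteredLieSuperalgebra L) (g' : FilteredLieSuperalgebra M) where
  equiv : L ≃ₗ[ℝ] M
  map_bracket : ∀ x y, equiv (g.bracket x y) = g'.bracket (equiv x) (equiv y)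
  map_part : ∀ (e : ZMod 2) (x : L), x ∈ g.part e ↔ equiv x ∈ g'.part e
  map_filt : ∀ (i : ℤ) (x : L), x ∈ g.filt i ↔ equiv x ∈ g'.filt i

/-! ### The associated graded superalgebra of a filtered Lie superalgebra -/

namespace FilteredLieSuperalgebra

variable {L : Type*} [AddCommGroup L] [Module ℝ L] (g : FilteredLieSuperalgebra L)

/-- The component of degree `i` of the associated graded superalgebra. -/
abbrev Gr (i : ℤ) : Type _ :=
  ↥(g.filt i) ⧸ (g.filt (i + 1)).submoduleOf (g.filt i)

/-- The class in `Gr i` of an element of `filt i`. -/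
def grMk (i : ℤ) : ↥(g.filt i) →ₗ[ℝ] g.Gr i :=
  ((g.filt (i + 1)).submoduleOf (g.filt i)).mkQ

/-- The part of parity `e` of the component of degree `i`. -/
def grPart (i : ℤ) (e : ZMod 2) : Submodule ℝ (g.Gr i) :=
  ((g.part e).submoduleOf (g.filt i)).map (g.grMk i)

/-- The bracket `filt i × filt j → filt (i + j)` followed by the passage to `Gr (i + j)`. -/
def preGrBracket (i j : ℤ) : ↥(g.filt i) →ₗ[ℝ] ↥(g.filt j) →ₗ[ℝ] g.Gr (i + j) :=
  LinearMap.mk₂ ℝ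
    (fun x y => g.grMk (i + j) ⟨g.bracket x y, g.filt_bracket_mem x.2 y.2⟩)
    (fun x x' y => by rw [← map_add]; congr 1; ext; simp)
    (fun c x y => by rw [← map_smul]; congr 1; ext; simp)
    (fun x y y' => by rw [← map_add]; congr 1; ext; simp)
    (fun c x y => by rw [← map_smul]; congr 1; ext; simp)

theorem preGrBracket_left (i j : ℤ) (x : ↥(g.filt i)) (hx : (x : L) ∈ g.filt (i + 1)) :
    g.preGrBracket i j x = 0 := by
  ext y
  refine (Submodule.Quotient.mk_eq_zero _).2 ?_
  have := g.filt_bracket_mem hx y.2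
  rw [show i + 1 + j = i + j + 1 by ring] at this
  exact this

theorem preGrBracket_right (i j : ℤ) (x : ↥(g.filt i)) (y : ↥(g.filt j))
    (hy : (y : L) ∈ g.filt (j + 1)) : g.preGrBracket i j x y = 0 := by
  refine (Submodule.Quotient.mk_eq_zero _).2 ?_
  have := g.filt_bracket_mem x.2 hy
  rw [← add_assoc] at this
  exact this

/-- The bracket of the associated graded superalgebra. -/
def grBracket (i j : ℤ) : g.Gr i →ₗ[ℝ] g.Gr j →ₗ[ℝ] g.Gr (i + j) :=
  LinearMap.flip (Submodule.liftQ _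
    (LinearMap.flip (Submodule.liftQ _ (g.preGrBracket i j)
      (fun x hx => g.preGrBracket_left i j x hx)))
    (fun y hy => by
      ext x
      exact g.preGrBracket_right i j x y hy))

theorem grBracket_mk (i j : ℤ) (x : ↥(g.filt i)) (y : ↥(g.filt j)) :
    g.grBracket i j (g.grMk i x) (g.grMk j y) =
      g.grMk (i + j) ⟨g.bracket x y, g.filt_bracket_mem x.2 y.2⟩ := rfl

end FilteredLieSuperalgebra

/-- An isomorphism of graded Lie superalgebras from the associated graded superalgebra of `g`
to `a`. A filtered deformation of `a` is a filtered Lie superalgebra `g` with such an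
isomorphism. -/
structure GrIso {L K : Type*} [AddCommGroup L] [Module ℝ L] [AddCommGroup K] [Module ℝ K]
    (g : FilteredLieSuperalgebra L) (a : GradedLieSuperalgebra K) where
  equiv : ∀ i : ℤ, g.Gr i ≃ₗ[ℝ] ↥(a.deg i)
  map_bracket : ∀ (i j : ℤ) (x : g.Gr i) (y : g.Gr j),
    (equiv (i + j) (g.grBracket i j x y) : K) = a.bracket (equiv i x) (equiv j y)
  map_part : ∀ (i : ℤ) (e : ZMod 2) (x : g.Gr i),
    x ∈ g.grPart i e ↔ (equiv i x : K) ∈ a.part e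

/-! ### Homogeneous components and the Spencer complex -/

namespace GradedLieSuperalgebra

variable {K : Type*} [AddCommGroup K] [Module ℝ K] (a : GradedLieSuperalgebra K)

/-- The decomposition of an element into its homogeneous components. -/
def decomp : K ≃ₗ[ℝ] ⨁ i, ↥(a.deg i) :=
  (LinearEquiv.ofBijective (DirectSum.coeLinearMap a.deg) a.deg_internal).symm

/-- The projection onto the component of degree `i`. -/
def proj (i : ℤ) : K →ₗ[ℝ] K :=
  (a.deg i).subtype ∘ₗ DirectSum.component ℝ ℤ (fun i => ↥(a.deg i)) i ∘ₗ a.decomp.toLinearMap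

theorem decomp_of_mem {i : ℤ} {x : K} (hx : x ∈ a.deg i) :
    a.decomp x = DirectSum.lof ℝ ℤ (fun i => ↥(a.deg i)) i ⟨x, hx⟩ := by
  refine (LinearEquiv.symm_apply_eq _).2 ?_
  exact (DirectSum.coeLinearMap_lof a.deg i ⟨x, hx⟩).symm

/-- The component of degree `d` of a bilinear map `B : K × K → K`. -/
def bilinComponent (d : ℤ) (B : K →ₗ[ℝ] K →ₗ[ℝ] K) : K →ₗ[ℝ] K →ₗ[ℝ] K :=
  (DirectSum.toModule ℝ ℤ (K →ₗ[ℝ] K) fun i =>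
    LinearMap.flip ((DirectSum.toModule ℝ ℤ (↥(a.deg i) →ₗ[ℝ] K) fun j =>
      LinearMap.flip ((B.compr₂ (a.proj (i + j + d))).domRestrict₁₂ (a.deg i) (a.deg j))) ∘ₗ
        a.decomp.toLinearMap)) ∘ₗ a.decomp.toLinearMap

theorem bilinComponent_apply (d : ℤ) (B : K →ₗ[ℝ] K →ₗ[ℝ] K) {i j : ℤ} {x y : K}
    (hx : x ∈ a.deg i) (hy : y ∈ a.deg j) :
    a.bilinComponent d B x y = a.proj (i + j + d) (B x y) := by
  simp [bilinComponent, a.decomp_of_mem hx, a.decomp_of_mem hy]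
  rfl

/-- The negatively graded part `a₋`. -/
def neg : Submodule ℝ K := ⨆ i : {i : ℤ // i < 0}, a.deg i

theorem deg_le_neg {i : ℤ} (hi : i < 0) : a.deg i ≤ a.neg :=
  le_iSup (fun i : {i : ℤ // i < 0} => a.deg i) ⟨i, hi⟩

theorem bracket_mem_neg {x y : K} (hx : x ∈ a.neg) (hy : y ∈ a.neg) :
    a.bracket x y ∈ a.neg := by
  refine Submodule.iSup_induction _ (motive := fun x => a.bracket x y ∈ a.neg) hx ?_ ?_ ?_
  · intro i x hx
    refine Submodule.iSup_induction _ (motive := fun y => a.bracket x y ∈ a.neg) hy ?_ ?_ ?_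
    · intro j y hy
      exact a.deg_le_neg (add_neg i.2 j.2) (a.deg_bracket_mem hx hy)
    · simp
    · intro y z hy hz
      rw [map_add]
      exact add_mem hy hz
  · simp
  · intro x z hx hz
    rw [map_add, LinearMap.add_apply]
    exact add_mem hx hz

theorem ad_mem_neg {A y : K} (hA : A ∈ a.deg 0) (hy : y ∈ a.neg) :
    a.bracket A y ∈ a.neg := by
  refine Submodule.iSup_induction _ (motive := fun y => a.bracket A y ∈ a.neg) hy ?_ ?_ ?_
  · intro j y hy
    refine a.deg_le_neg (i := 0 + j) ?_ (a.deg_bracket_mem hA hy)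
    rw [zero_add]
    exact j.2
  · simp
  · intro y z hy hz
    rw [map_add]
    exact add_mem hy hz

/-- The bracket of the subalgebra `a₋`. -/
def negBracket (x y : ↥a.neg) : ↥a.neg := ⟨a.bracket x y, a.bracket_mem_neg x.2 y.2⟩

/-- The adjoint action of the subalgebra of degree zero on `a₋`. -/
def adNeg (A : ↥(a.deg 0)) : ↥a.neg →ₗ[ℝ] ↥a.neg :=
  (a.bracket A).restrict fun _ hy => a.ad_mem_neg A.2 hy

/-- The space `C^{d,1}(a₋, a)` of Spencer `1`-cochains of degree `d`. -/
def cochains₁ (d : ℤ) : Submodule ℝ (↥a.neg →ₗ[ℝ] K) where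
  carrier := {ψ | ∀ (i : ℤ) (x : ↥a.neg), (x : K) ∈ a.deg i → ψ x ∈ a.deg (i + d)}
  add_mem' := fun hp hq i x hx => add_mem (hp i x hx) (hq i x hx)
  zero_mem' := fun _ _ _ => zero_mem _
  smul_mem' := fun c _ hp i x hx => Submodule.smul_mem _ c (hp i x hx)

/-- The space `C^{d,2}(a₋, a)` of Spencer `2`-cochains of degree `d`: linear maps of degree `d`
from the exterior square, in the super sense, of `a₋` to `a`. -/
def cochains₂ (d : ℤ) : Submodule ℝ (↥a.neg →ₗ[ℝ] ↥a.neg →ₗ[ℝ] K) where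
  carrier := {ζ |
    (∀ (i j : ℤ) (x y : ↥a.neg), (x : K) ∈ a.deg i → (y : K) ∈ a.deg j →
      ζ x y ∈ a.deg (i + j + d)) ∧
    (∀ (i j : ZMod 2) (x y : ↥a.neg), (x : K) ∈ a.part i → (y : K) ∈ a.part j →
      ζ x y = -(superSign i j • ζ y x))}
  add_mem' := fun hp hq =>
    ⟨fun i j x y hx hy => add_mem (hp.1 i j x y hx hy) (hq.1 i j x y hx hy),
      fun i j x y hx hy => by
        simp only [LinearMap.add_apply]
        rw [hp.2 i j x y hx hy, hq.2 i j x y hx hy, smul_add, neg_add]⟩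
  zero_mem' := ⟨fun _ _ _ _ _ _ => zero_mem _, fun _ _ _ _ _ _ => by simp⟩
  smul_mem' := fun c ζ hp =>
    ⟨fun i j x y hx hy => Submodule.smul_mem _ c (hp.1 i j x y hx hy),
      fun i j x y hx hy => by
        simp only [LinearMap.smul_apply]
        rw [hp.2 i j x y hx hy, smul_neg, smul_comm]⟩

/-- The Spencer differential `∂ψ(x, y)` of a `1`-cochain of even degree, for `x` of parity `i`
and `y` of parity `j`. -/
def spencer₁ (ψ : ↥a.neg →ₗ[ℝ] K) (i j : ZMod 2) (x y : ↥a.neg) : K :=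
  a.bracket x (ψ y) - superSign i j • a.bracket y (ψ x) - ψ (a.negBracket x y)

/-- The Spencer differential `∂ζ(x, y, z)` of a `2`-cochain of even degree, for `x`, `y`, `z` of
parities `i`, `j`, `k`. -/
def spencer₂ (ζ : ↥a.neg →ₗ[ℝ] ↥a.neg →ₗ[ℝ] K) (i j k : ZMod 2) (x y z : ↥a.neg) : K :=
  a.bracket x (ζ y z) + superSign i (j + k) • a.bracket y (ζ z x)
    + superSign k (i + j) • a.bracket z (ζ x y)
    - ζ (a.negBracket x y) z - superSign i (j + k) • ζ (a.negBracket y z) x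
    - superSign k (i + j) • ζ (a.negBracket z x) y

/-- The `2`-cocycles of (even) degree `d`. -/
def cocycles₂ (d : ℤ) : Submodule ℝ (↥a.neg →ₗ[ℝ] ↥a.neg →ₗ[ℝ] K) where
  carrier := {ζ | ζ ∈ a.cochains₂ d ∧ ∀ (i j k : ZMod 2) (x y z : ↥a.neg),
    (x : K) ∈ a.part i → (y : K) ∈ a.part j → (z : K) ∈ a.part k →
      a.spencer₂ ζ i j k x y z = 0}
  add_mem' := fun {p q} hp hq => ⟨add_mem hp.1 hq.1, fun i j k x y z hx hy hz => by
    have h := congrArg₂ (· + ·) (hp.2 i j k x y z hx hy hz) (hq.2 i j k x y z hx hy hz)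
    simp only [add_zero] at h
    rw [← h]
    simp only [spencer₂, LinearMap.add_apply, map_add, smul_add]
    abel⟩
  zero_mem' := ⟨zero_mem _, fun i j k x y z _ _ _ => by simp [spencer₂]⟩
  smul_mem' := fun c p hp => ⟨Submodule.smul_mem _ c hp.1, fun i j k x y z hx hy hz => by
    have h := congrArg (fun v => c • v) (hp.2 i j k x y z hx hy hz)
    simp only [smul_zero] at h
    rw [← h]
    simp only [spencer₂, LinearMap.smul_apply, map_smul]
    module⟩

/-- The `2`-coboundaries of (even) degree `d`. -/
def coboundaries₂ (d : ℤ) : Submodule ℝ (↥a.neg →ₗ[ℝ] ↥a.neg →ₗ[ℝ] K) where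
  carrier := {ζ | ∃ ψ ∈ a.cochains₁ d, ∀ (i j : ZMod 2) (x y : ↥a.neg),
    (x : K) ∈ a.part i → (y : K) ∈ a.part j → ζ x y = a.spencer₁ ψ i j x y}
  add_mem' := by
    rintro p q ⟨ψ, hψ, hp⟩ ⟨χ, hχ, hq⟩
    refine ⟨ψ + χ, add_mem hψ hχ, fun i j x y hx hy => ?_⟩
    rw [LinearMap.add_apply, LinearMap.add_apply, hp i j x y hx hy, hq i j x y hx hy]
    simp only [spencer₁, LinearMap.add_apply, map_add, smul_add]
    abel
  zero_mem' := ⟨0, zero_mem _, fun i j x y _ _ => by simp [spencer₁]⟩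
  smul_mem' := by
    rintro c p ⟨ψ, hψ, hp⟩
    refine ⟨c • ψ, Submodule.smul_mem _ c hψ, fun i j x y hx hy => ?_⟩
    rw [LinearMap.smul_apply, LinearMap.smul_apply, hp i j x y hx hy]
    simp only [spencer₁, LinearMap.smul_apply, map_smul]
    module

/-- The Spencer cohomology group `H^{d,2}(a₋, a)`, for even `d`. -/
abbrev H₂ (d : ℤ) : Type _ :=
  ↥(a.cocycles₂ d) ⧸ (a.coboundaries₂ d).submoduleOf (a.cocycles₂ d)

/-- The cohomology class of a `2`-cocycle. -/
def cohClass (d : ℤ) : ↥(a.cocycles₂ d) →ₗ[ℝ] a.H₂ d :=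
  ((a.coboundaries₂ d).submoduleOf (a.cocycles₂ d)).mkQ

/-- The action of the degree zero subalgebra on bilinear maps `a₋ × a₋ → a`:
`(A · ζ)(x, y) = [A, ζ(x, y)] - ζ([A, x], y) - ζ(x, [A, y])`. -/
def act₂ (A : ↥(a.deg 0)) :
    (↥a.neg →ₗ[ℝ] ↥a.neg →ₗ[ℝ] K) →ₗ[ℝ] (↥a.neg →ₗ[ℝ] ↥a.neg →ₗ[ℝ] K) where
  toFun ζ := ζ.compr₂ (a.bracket A) - ζ ∘ₗ a.adNeg A - ζ.compl₂ (a.adNeg A)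
  map_add' p q := by ext x y; simp; abel
  map_smul' c p := by ext x y; simp [smul_sub]

theorem act₂_apply (A : ↥(a.deg 0)) (ζ : ↥a.neg →ₗ[ℝ] ↥a.neg →ₗ[ℝ] K) (x y : ↥a.neg) :
    a.act₂ A ζ x y = a.bracket A (ζ x y) - ζ (a.adNeg A x) y - ζ x (a.adNeg A y) := rfl

theorem mem_part_zero {A : K} (hA : A ∈ a.deg 0) : A ∈ a.part 0 := by
  simpa using a.deg_le_part 0 hA

theorem ad_mem_part {A x : K} {i : ZMod 2} (hA : A ∈ a.deg 0) (hx : x ∈ a.part i) :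
    a.bracket A x ∈ a.part i := by
  simpa using a.bracket_mem (a.mem_part_zero hA) hx

theorem ad_mem_deg {A x : K} {i : ℤ} (hA : A ∈ a.deg 0) (hx : x ∈ a.deg i) :
    a.bracket A x ∈ a.deg i := by
  simpa using a.deg_bracket_mem hA hx

/-- The adjoint action of a degree zero element is a derivation. -/
theorem ad_bracket {A : K} (hA : A ∈ a.deg 0) (x y : K) :
    a.bracket A (a.bracket x y) =
      a.bracket (a.bracket A x) y + a.bracket x (a.bracket A y) := by
  have top := a.part_internal.submodule_iSup_eq_top
  have hx : x ∈ ⨆ e, a.part e := top ▸ Submodule.mem_top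
  have hy : y ∈ ⨆ e, a.part e := top ▸ Submodule.mem_top
  refine Submodule.iSup_induction _ (motive := fun x => a.bracket A (a.bracket x y) =
      a.bracket (a.bracket A x) y + a.bracket x (a.bracket A y)) hx ?_ (by simp) ?_
  · intro i x hx
    refine Submodule.iSup_induction _ (motive := fun y => a.bracket A (a.bracket x y) =
      a.bracket (a.bracket A x) y + a.bracket x (a.bracket A y)) hy ?_ (by simp) ?_
    · intro j y hy
      rw [a.jacobi (a.mem_part_zero hA) hx hy]
      simp [superSign]
    · intro y z h1 h2
      simp only [map_add, h1, h2]
      abel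
  · intro x z h1 h2
    simp only [map_add, LinearMap.add_apply, h1, h2]
    abel

theorem adNeg_negBracket (A : ↥(a.deg 0)) (x y : ↥a.neg) :
    a.adNeg A (a.negBracket x y) =
      a.negBracket (a.adNeg A x) y + a.negBracket x (a.adNeg A y) :=
  Subtype.ext (a.ad_bracket A.2 x y)

theorem act₂_mem_cochains {d : ℤ} (A : ↥(a.deg 0)) {ζ : ↥a.neg →ₗ[ℝ] ↥a.neg →ₗ[ℝ] K}
    (hζ : ζ ∈ a.cochains₂ d) : a.act₂ A ζ ∈ a.cochains₂ d := by
  refine ⟨fun i j x y hx hy => ?_, fun i j x y hx hy => ?_⟩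
  · rw [act₂_apply]
    exact sub_mem (sub_mem (a.ad_mem_deg A.2 (hζ.1 i j x y hx hy))
      (hζ.1 i j _ y (a.ad_mem_deg A.2 hx) hy)) (hζ.1 i j x _ hx (a.ad_mem_deg A.2 hy))
  · rw [act₂_apply, act₂_apply, hζ.2 i j x y hx hy,
      hζ.2 i j (a.adNeg A x) y (a.ad_mem_part A.2 hx) hy,
      hζ.2 i j x (a.adNeg A y) hx (a.ad_mem_part A.2 hy)]
    simp only [map_neg, map_smul]
    module

theorem act₂_mem_cocycles {d : ℤ} (A : ↥(a.deg 0)) {ζ : ↥a.neg →ₗ[ℝ] ↥a.neg →ₗ[ℝ] K}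
    (hζ : ζ ∈ a.cocycles₂ d) : a.act₂ A ζ ∈ a.cocycles₂ d := by
  refine ⟨a.act₂_mem_cochains A hζ.1, fun i j k x y z hx hy hz => ?_⟩
  have h0 := congrArg (a.bracket A) (hζ.2 i j k x y z hx hy hz)
  have h1 := hζ.2 i j k (a.adNeg A x) y z (a.ad_mem_part A.2 hx) hy hz
  have h2 := hζ.2 i j k x (a.adNeg A y) z hx (a.ad_mem_part A.2 hy) hz
  have h3 := hζ.2 i j k x y (a.adNeg A z) hx hy (a.ad_mem_part A.2 hz)
  have key : a.spencer₂ (a.act₂ A ζ) i j k x y z =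
      a.bracket A (a.spencer₂ ζ i j k x y z) - a.spencer₂ ζ i j k (a.adNeg A x) y z
        - a.spencer₂ ζ i j k x (a.adNeg A y) z - a.spencer₂ ζ i j k x y (a.adNeg A z) := by
    have c : ∀ x : ↥a.neg, ((a.adNeg A x : ↥a.neg) : K) = a.bracket A x := fun _ => rfl
    simp only [spencer₂, act₂_apply, adNeg_negBracket, map_add, map_sub, map_smul,
      a.ad_bracket A.2, LinearMap.add_apply, c]
    module
  rw [key, h0, h1, h2, h3]
  simp

theorem act₂_mem_coboundaries {d : ℤ} (A : ↥(a.deg 0)) {ζ : ↥a.neg →ₗ[ℝ] ↥a.neg →ₗ[ℝ] K}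
    (hζ : ζ ∈ a.coboundaries₂ d) : a.act₂ A ζ ∈ a.coboundaries₂ d := by
  obtain ⟨ψ, hψ, h⟩ := hζ
  refine ⟨a.bracket A ∘ₗ ψ - ψ ∘ₗ a.adNeg A, fun i x hx => ?_, fun i j x y hx hy => ?_⟩
  · exact sub_mem (a.ad_mem_deg A.2 (hψ i x hx)) (hψ i _ (a.ad_mem_deg A.2 hx))
  · have c : ∀ x : ↥a.neg, ((a.adNeg A x : ↥a.neg) : K) = a.bracket A x := fun _ => rfl
    rw [act₂_apply, h i j x y hx hy, h i j _ y (a.ad_mem_part A.2 hx) hy,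
      h i j x _ hx (a.ad_mem_part A.2 hy)]
    simp only [spencer₁, adNeg_negBracket, map_add, map_sub, map_smul, a.ad_bracket A.2,
      LinearMap.sub_apply, LinearMap.comp_apply, c]
    module

/-- The induced action of the degree zero subalgebra on `H^{d,2}(a₋, a)`. -/
def actH₂ (d : ℤ) (A : ↥(a.deg 0)) : a.H₂ d →ₗ[ℝ] a.H₂ d :=
  Submodule.mapQ _ _ ((a.act₂ A).restrict fun _ h => a.act₂_mem_cocycles A h)
    (fun _ h => a.act₂_mem_coboundaries A h)

/-- Invariance of a cohomology class under the degree zero subalgebra. -/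
def IsInvariantClass (d : ℤ) (c : a.H₂ d) : Prop := ∀ A : ↥(a.deg 0), a.actH₂ d A c = 0

end GradedLieSuperalgebra

/-! ### The degree `2` part of the bracket of a filtered deformation -/

/-- An identification of the super vector space `a` with the filtered super vector space `g`
that induces the given isomorphism of `a` with the associated graded superalgebra of `g`. -/
structure Splitting {L K : Type*} [AddCommGroup L] [Module ℝ L] [AddCommGroup K] [Module ℝ K]
    {g : FilteredLieSuperalgebra L} {a : GradedLieSuperalgebra K} (φ : GrIso g a) where
  equiv : K ≃ₗ[ℝ] L
  map_part : ∀ (e : ZMod 2) (x : K), x ∈ a.part e → equiv x ∈ g.part e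
  map_deg : ∀ (i : ℤ) (x : K), x ∈ a.deg i → equiv x ∈ g.filt i
  symbol : ∀ (i : ℤ) (x : K) (hx : x ∈ a.deg i),
    (φ.equiv i (g.grMk i ⟨equiv x, map_deg i x hx⟩) : K) = x

namespace Splitting

variable {L K : Type*} [AddCommGroup L] [Module ℝ L] [AddCommGroup K] [Module ℝ K]
  {g : FilteredLieSuperalgebra L} {a : GradedLieSuperalgebra K} {φ : GrIso g a}

/-- The bracket of `g` transported to the vector space `a`. -/
def bracket (Θ : Splitting φ) : K →ₗ[ℝ] K →ₗ[ℝ] K :=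
  (g.bracket.compl₁₂ Θ.equiv.toLinearMap Θ.equiv.toLinearMap).compr₂ Θ.equiv.symm.toLinearMap

/-- The restriction to `a₋ × a₋` of the component of degree `2` of the bracket of `g`. -/
def mu (Θ : Splitting φ) : ↥a.neg →ₗ[ℝ] ↥a.neg →ₗ[ℝ] K :=
  (a.bilinComponent 2 Θ.bracket).domRestrict₁₂ a.neg a.neg

end Splitting

/-! ### Graded subalgebras -/

/-- A `ℤ`-graded subalgebra of a graded Lie superalgebra. -/
structure GradedSubalgebra {L : Type*} [AddCommGroup L] [Module ℝ L]
    (p : GradedLieSuperalgebra L) where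
  carrier : Submodule ℝ L
  homogeneous : carrier = ⨆ i : ℤ, carrier ⊓ p.deg i
  bracket_mem : ∀ {x y : L}, x ∈ carrier → y ∈ carrier → p.bracket x y ∈ carrier

theorem isInternal_submoduleOf {ι L : Type*} [DecidableEq ι] [AddCommGroup L] [Module ℝ L]
    {P : ι → Submodule ℝ L} (hP : DirectSum.IsInternal P) (W : Submodule ℝ L)
    (hW : W ≤ ⨆ i, W ⊓ P i) : DirectSum.IsInternal fun i => (P i).submoduleOf W := by
  refine DirectSum.isInternal_submodule_of_iSupIndep_of_iSup_eq_top ?_ ?_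
  · have h := hP.submodule_iSupIndep
    intro i
    have hi := h i
    rw [Submodule.disjoint_def] at hi ⊢
    intro x hx hx'
    apply Subtype.ext
    refine hi x hx ?_
    have : (W.subtype x) ∈ (⨆ j, ⨆ (_ : j ≠ i), (P j).submoduleOf W).map W.subtype :=
      Submodule.mem_map_of_mem hx'
    rw [Submodule.map_iSup] at this
    have le : (⨆ j, (⨆ (_ : j ≠ i), (P j).submoduleOf W).map W.subtype) ≤
        ⨆ j, ⨆ (_ : j ≠ i), P j := by
      refine iSup_mono fun j => ?_
      rw [Submodule.map_iSup]
      exact iSup_mono fun _ => Submodule.map_comap_le _ _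
    exact le this
  · apply Submodule.map_injective_of_injective W.injective_subtype
    rw [Submodule.map_iSup, Submodule.map_top, Submodule.range_subtype]
    refine le_antisymm (iSup_le fun i => Submodule.map_subtype_le _ _) (hW.trans ?_)
    refine iSup_mono fun i => ?_
    rw [Submodule.submoduleOf, Submodule.map_comap_subtype]

/-- A graded subalgebra is a graded Lie superalgebra. -/
def GradedSubalgebra.toGraded {L : Type*} [AddCommGroup L] [Module ℝ L]
    {p : GradedLieSuperalgebra L} (a : GradedSubalgebra p) :
    GradedLieSuperalgebra ↥a.carrier where
  part e := (p.part e).submoduleOf a.carrier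
  part_internal := isInternal_submoduleOf p.part_internal _ (by
    conv_lhs => rw [a.homogeneous]
    exact iSup_le fun i => le_trans (inf_le_inf_left _ (p.deg_le_part i))
      (le_iSup (fun e => a.carrier ⊓ p.part e) (i : ZMod 2)))
  bracket := LinearMap.mk₂ ℝ (fun x y => ⟨p.bracket x y, a.bracket_mem x.2 y.2⟩)
    (fun x x' y => by ext; simp) (fun c x y => by ext; simp)
    (fun x y y' => by ext; simp) (fun c x y => by ext; simp)
  bracket_mem hx hy := p.bracket_mem hx hy
  skew hx hy := Subtype.ext (p.skew hx hy)
  jacobi hx hy hz := Subtype.ext (p.jacobi hx hy hz)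
  deg i := (p.deg i).submoduleOf a.carrier
  deg_internal := isInternal_submoduleOf p.deg_internal _ a.homogeneous.le
  deg_bracket_mem hx hy := p.deg_bracket_mem hx hy
  deg_le_part i := fun _ hx => p.deg_le_part i hx

/-! ### Lorentzian vector spaces and spinors -/

/-- The diagonal entries of the Lorentzian inner product in an orthonormal basis. -/
def lorentzSign : Fin 4 → ℝ := ![1, -1, -1, -1]

/-- A Lorentzian inner product of signature `(+,-,-,-)` on a four-dimensional vector space. -/
structure LorentzForm (V : Type*) [AddCommGroup V] [Module ℝ V] where
  form : LinearMap.BilinForm ℝ V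
  exists_basis : ∃ b : Module.Basis (Fin 4) ℝ V,
    ∀ i j, form (b i) (b j) = if i = j then lorentzSign i else 0

attribute [local instance] LieRing.ofAssociativeRing

namespace LorentzForm

variable {V : Type*} [AddCommGroup V] [Module ℝ V] (η : LorentzForm V)

/-- A chosen orthonormal basis. The notions defined through it below do not depend on it. -/
def basis : Module.Basis (Fin 4) ℝ V := η.exists_basis.choose

theorem form_basis (i j : Fin 4) :
    η.form (η.basis i) (η.basis j) = if i = j then lorentzSign i else 0 :=
  η.exists_basis.choose_spec i j

theorem lorentzSign_mul_self (i : Fin 4) : lorentzSign i * lorentzSign i = 1 := by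
  fin_cases i <;> simp [lorentzSign]

theorem form_basis_left (i : Fin 4) (v : V) :
    η.form (η.basis i) v = lorentzSign i * η.basis.repr v i := by
  have h : η.form (η.basis i) (∑ j, η.basis.repr v j • η.basis j) =
      lorentzSign i * η.basis.repr v i := by
    simp only [map_sum, map_smul, form_basis, smul_eq_mul]
    simp [mul_comm]
  rwa [η.basis.sum_repr v] at h

theorem symm (v w : V) : η.form v w = η.form w v := by
  have : η.form = η.form.flip := by
    refine η.basis.ext fun i => η.basis.ext fun j => ?_
    change η.form (η.basis i) (η.basis j) = η.form (η.basis j) (η.basis i)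
    rw [form_basis, form_basis]
    by_cases h : i = j
    · simp [h]
    · simp [h, Ne.symm h]
  exact congrArg (fun f => f v w) this

theorem sum_basis (v : V) :
    ∑ i, (lorentzSign i * η.form (η.basis i) v) • η.basis i = v := by
  conv_rhs => rw [← η.basis.sum_repr v]
  refine Finset.sum_congr rfl fun i _ => ?_
  rw [form_basis_left, ← mul_assoc, lorentzSign_mul_self, one_mul]

/-- The Lie algebra `so(V)` of skew-symmetric endomorphisms. -/
abbrev so : LieSubalgebra ℝ (Module.End ℝ V) := skewAdjointLieSubalgebra η.form

theorem so_skew (A : ↥η.so) (v w : V) : η.form (A.1 v) w = -η.form v (A.1 w) := by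
  have h := (LinearMap.mem_skewAdjointSubmodule (B := η.form) A.1).1 A.2
  simpa using h v w

/-- The quadratic form `v ↦ -η(v, v)`, so that `v² = -η(v, v)` in its Clifford algebra. -/
def quad : QuadraticForm ℝ V := -(LinearMap.BilinMap.toQuadraticMap η.form)

/-- The Clifford algebra `Cℓ(V)`, with `v² = -η(v, v)`. -/
abbrev Cl : Type _ := CliffordAlgebra η.quad

/-- The inclusion of `V` in the Clifford algebra. -/
abbrev ι : V →ₗ[ℝ] η.Cl := CliffordAlgebra.ι η.quad

theorem ι_sq (v : V) : η.ι v * η.ι v = algebraMap ℝ η.Cl (-η.form v v) := by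
  rw [CliffordAlgebra.ι_sq_scalar]
  rfl

theorem ι_mul_add_swap (v w : V) :
    η.ι v * η.ι w + η.ι w * η.ι v = (-2 * η.form v w) • (1 : η.Cl) := by
  have h1 := η.ι_sq (v + w)
  have h2 := η.ι_sq v
  have h3 := η.ι_sq w
  simp only [map_add, add_mul, mul_add, LinearMap.add_apply, h2, h3, η.symm w v] at h1
  simp only [Algebra.algebraMap_eq_smul_one] at h1
  have : η.ι v * η.ι w + η.ι w * η.ι v =
      ((-η.form v v) • (1 : η.Cl) + η.ι w * η.ι v + (η.ι v * η.ι w + (-η.form w w) • (1 : η.Cl)))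
        - (-η.form v v) • (1 : η.Cl) - (-η.form w w) • (1 : η.Cl) := by abel
  rw [this, h1]
  module

/-- The endomorphism `v ∧ w : u ↦ η(u, v) w - η(u, w) v`. -/
def wedge (v w : V) : Module.End ℝ V :=
  (η.form v).smulRight w - (η.form w).smulRight v

/-- The image in the Clifford algebra of an endomorphism of `V`, regarded as a bivector; the
embedding of `so(V)` in `Cℓ(V)` is its restriction, and it sends `v ∧ w` to `¼ [v, w]`
(see `spin_wedge`). -/
def spin : Module.End ℝ V →ₗ[ℝ] η.Cl where
  toFun A := (1 / 8 : ℝ) • ∑ i, lorentzSign i •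
    (η.ι (η.basis i) * η.ι (A (η.basis i)) - η.ι (A (η.basis i)) * η.ι (η.basis i))
  map_add' A B := by
    rw [← smul_add, ← Finset.sum_add_distrib]
    refine congrArg (fun z : η.Cl => (1 / 8 : ℝ) • z) (Finset.sum_congr rfl fun i _ => ?_)
    simp only [LinearMap.add_apply, map_add, mul_add, add_mul]
    module
  map_smul' c A := by
    rw [RingHom.id_apply, smul_comm c (1 / 8 : ℝ), Finset.smul_sum (r := c)]
    refine congrArg (fun z : η.Cl => (1 / 8 : ℝ) • z) (Finset.sum_congr rfl fun i _ => ?_)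
    simp only [LinearMap.smul_apply, map_smul, mul_smul_comm, smul_mul_assoc]
    module

theorem spin_wedge (v w : V) :
    η.spin (η.wedge v w) = (1 / 4 : ℝ) • (η.ι v * η.ι w - η.ι w * η.ι v) := by
  have h : ∀ u : V, ∑ i, (lorentzSign i * η.form (η.basis i) u) • η.ι (η.basis i) = η.ι u := by
    intro u
    conv_rhs => rw [← η.sum_basis u]
    simp
  have e : η.spin (η.wedge v w) = (1 / 8 : ℝ) •
      (((∑ i, (lorentzSign i * η.form (η.basis i) v) • η.ι (η.basis i)) * η.ι w
        - (∑ i, (lorentzSign i * η.form (η.basis i) w) • η.ι (η.basis i)) * η.ι v)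
      - (η.ι w * (∑ i, (lorentzSign i * η.form (η.basis i) v) • η.ι (η.basis i))
        - η.ι v * (∑ i, (lorentzSign i * η.form (η.basis i) w) • η.ι (η.basis i)))) := by
    simp only [spin, LinearMap.coe_mk, AddHom.coe_mk]
    congr 1
    simp only [Finset.sum_mul, Finset.mul_sum, ← Finset.sum_sub_distrib]
    refine Finset.sum_congr rfl fun i _ => ?_
    simp only [wedge, LinearMap.sub_apply, LinearMap.smulRight_apply, η.symm _ (η.basis i),
      map_sub, map_smul, mul_sub, sub_mul, mul_smul_comm, smul_mul_assoc]
    module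
  rw [e, h, h]
  module

theorem commutator_ι (x y u : V) :
    (η.ι x * η.ι y - η.ι y * η.ι x) * η.ι u - η.ι u * (η.ι x * η.ι y - η.ι y * η.ι x) =
      (4 * η.form x u) • η.ι y - (4 * η.form y u) • η.ι x := by
  have hx := η.ι_mul_add_swap x u
  have hy := η.ι_mul_add_swap y u
  have e : (η.ι x * η.ι y - η.ι y * η.ι x) * η.ι u - η.ι u * (η.ι x * η.ι y - η.ι y * η.ι x) =
      η.ι x * (η.ι y * η.ι u + η.ι u * η.ι y) - (η.ι x * η.ι u + η.ι u * η.ι x) * η.ι y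
      - η.ι y * (η.ι x * η.ι u + η.ι u * η.ι x)
      + (η.ι y * η.ι u + η.ι u * η.ι y) * η.ι x := by noncomm_ring
  rw [e, hx, hy]
  simp only [mul_smul_comm, smul_mul_assoc, mul_one, one_mul]
  module

theorem spin_commutator_ι (A : ↥η.so) (u : V) :
    η.spin A.1 * η.ι u - η.ι u * η.spin A.1 = η.ι (A.1 u) := by
  have e : η.spin A.1 * η.ι u - η.ι u * η.spin A.1 = (1 / 2 : ℝ) •
      (η.ι (A.1 (∑ i, (lorentzSign i * η.form (η.basis i) u) • η.basis i))
        + η.ι (∑ i, (lorentzSign i * η.form (η.basis i) (A.1 u)) • η.basis i)) := by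
    simp only [spin, LinearMap.coe_mk, AddHom.coe_mk, smul_mul_assoc, mul_smul_comm,
      ← smul_sub, Finset.sum_mul, Finset.mul_sum, ← Finset.sum_sub_distrib, map_sum, map_smul,
      ← Finset.sum_add_distrib, commutator_ι, so_skew]
    rw [Finset.smul_sum, Finset.smul_sum]
    refine Finset.sum_congr rfl fun i _ => ?_
    module
  rw [e, sum_basis, sum_basis]
  module

/-- Skew-symmetry of `A`, contracted with a bilinear map. -/
theorem sum_so_left {M : Type*} [AddCommGroup M] [Module ℝ M] (f : V →ₗ[ℝ] V →ₗ[ℝ] M)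
    (A : ↥η.so) :
    ∑ i, lorentzSign i • f (A.1 (η.basis i)) (η.basis i) =
      -∑ i, lorentzSign i • f (η.basis i) (A.1 (η.basis i)) := by
  have l : ∀ i, lorentzSign i • f (A.1 (η.basis i)) (η.basis i) =
      ∑ j, (lorentzSign i * lorentzSign j * η.form (η.basis j) (A.1 (η.basis i))) •
        f (η.basis j) (η.basis i) := by
    intro i
    conv_lhs => rw [← η.sum_basis (A.1 (η.basis i))]
    simp [Finset.smul_sum, smul_smul, mul_assoc]
  have r : ∀ j, lorentzSign j • f (η.basis j) (A.1 (η.basis j)) =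
      ∑ i, (lorentzSign i * lorentzSign j * η.form (η.basis i) (A.1 (η.basis j))) •
        f (η.basis j) (η.basis i) := by
    intro j
    conv_lhs => rw [← η.sum_basis (A.1 (η.basis j))]
    simp only [map_sum, map_smul, Finset.smul_sum, smul_smul]
    refine Finset.sum_congr rfl fun i _ => ?_
    congr 1
    ring
  rw [Finset.sum_congr rfl fun i _ => l i, Finset.sum_congr rfl fun i _ => r i,
    Finset.sum_comm, ← Finset.sum_neg_distrib]
  refine Finset.sum_congr rfl fun j _ => ?_
  rw [← Finset.sum_neg_distrib]
  refine Finset.sum_congr rfl fun i _ => ?_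
  rw [← neg_smul, η.symm (η.basis i), so_skew]
  congr 1
  ring

theorem spin_lie (A B : ↥η.so) :
    η.spin (⁅A, B⁆ : ↥η.so).1 = η.spin A.1 * η.spin B.1 - η.spin B.1 * η.spin A.1 := by
  have d : ∀ x y : V, η.spin A.1 * (η.ι x * η.ι y) - (η.ι x * η.ι y) * η.spin A.1 =
      η.ι (A.1 x) * η.ι y + η.ι x * η.ι (A.1 y) := by
    intro x y
    rw [← spin_commutator_ι, ← spin_commutator_ι]
    noncomm_ring
  have m1 := η.sum_so_left ((LinearMap.mul ℝ η.Cl).compl₁₂ η.ι (η.ι ∘ₗ B.1)) A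
  have m2 := η.sum_so_left ((LinearMap.mul ℝ η.Cl).flip.compl₁₂ η.ι (η.ι ∘ₗ B.1)) A
  simp only [LinearMap.compl₁₂_apply, LinearMap.mul_apply', LinearMap.comp_apply,
    LinearMap.flip_apply] at m1 m2
  have e : η.spin A.1 * η.spin B.1 - η.spin B.1 * η.spin A.1 = (1 / 8 : ℝ) •
      ((∑ i, lorentzSign i • (η.ι (A.1 (η.basis i)) * η.ι (B.1 (η.basis i))))
      - (∑ i, lorentzSign i • (η.ι (B.1 (η.basis i)) * η.ι (A.1 (η.basis i))))
      + ∑ i, lorentzSign i • (η.ι (η.basis i) * η.ι (A.1 (B.1 (η.basis i)))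
        - η.ι (A.1 (B.1 (η.basis i))) * η.ι (η.basis i))) := by
    conv_lhs =>
      rw [show η.spin B.1 = (1 / 8 : ℝ) • ∑ i, lorentzSign i •
        (η.ι (η.basis i) * η.ι (B.1 (η.basis i)) - η.ι (B.1 (η.basis i)) * η.ι (η.basis i))
        from rfl]
    simp only [smul_mul_assoc, mul_smul_comm, ← smul_sub, Finset.sum_mul, Finset.mul_sum,
      ← Finset.sum_sub_distrib, ← Finset.sum_add_distrib]
    congr 1
    refine Finset.sum_congr rfl fun i _ => ?_
    rw [← smul_add]
    congr 1
    have := congrArg₂ (· - ·) (d (η.basis i) (B.1 (η.basis i))) (d (B.1 (η.basis i)) (η.basis i))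
    rw [mul_sub, sub_mul, sub_sub_sub_comm, this]
    abel
  rw [e, m1, m2]
  simp only [spin, LinearMap.coe_mk, AddHom.coe_mk]
  congr 1
  rw [← Finset.sum_neg_distrib, ← Finset.sum_neg_distrib, ← Finset.sum_sub_distrib,
    ← Finset.sum_add_distrib]
  refine Finset.sum_congr rfl fun i _ => ?_
  have : (⁅A, B⁆ : ↥η.so).1 (η.basis i) =
      A.1 (B.1 (η.basis i)) - B.1 (A.1 (η.basis i)) := rfl
  rw [this]
  simp only [map_sub, mul_sub, sub_mul]
  module

end LorentzForm

/-- A symplectic form on the Clifford module `S` for which Clifford multiplication by vectors is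
skew-symmetric. -/
structure SpinorForm {V : Type*} [AddCommGroup V] [Module ℝ V] (η : LorentzForm V)
    (S : Type*) [AddCommGroup S] [Module ℝ S] [Module η.Cl S] where
  form : LinearMap.BilinForm ℝ S
  alternating : form.IsAlt
  nondegenerate : form.Nondegenerate
  clifford_skew : ∀ (v : V) (s t : S), form (η.ι v • s) t = -form s (η.ι v • t)

namespace SpinorForm

variable {V : Type*} [AddCommGroup V] [Module ℝ V] {η : LorentzForm V}
  {S : Type*} [AddCommGroup S] [Module ℝ S] [Module η.Cl S] [IsScalarTower ℝ η.Cl S]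

/-- The spinor representation of `so(V)` on `S`. -/
def sigma (η : LorentzForm V) (S : Type*) [AddCommGroup S] [Module ℝ S] [Module η.Cl S]
    [IsScalarTower ℝ η.Cl S] : ↥η.so →ₗ[ℝ] S →ₗ[ℝ] S :=
  LinearMap.mk₂ ℝ (fun A s => η.spin A.1 • s)
    (fun A B s => by simp [add_smul])
    (fun c A s => by simp)
    (fun A s t => by simp)
    (fun c A s => by rw [← algebraMap_smul η.Cl c s, ← algebraMap_smul η.Cl c (_ • s),
      ← mul_smul, ← mul_smul, Algebra.commutes])

theorem sigma_apply (A : ↥η.so) (s : S) : sigma η S A s = η.spin A.1 • s := rfl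

variable (ω : SpinorForm η S)

theorem form_symm (v : V) (s t : S) : ω.form s (η.ι v • t) = ω.form t (η.ι v • s) := by
  rw [← ω.alternating.neg_eq (η.ι v • s) t, ω.clifford_skew, neg_neg]

/-- Clifford multiplication as a bilinear map. -/
def cliffordMul (η : LorentzForm V) (S : Type*) [AddCommGroup S] [Module ℝ S] [Module η.Cl S]
    [IsScalarTower ℝ η.Cl S] : V →ₗ[ℝ] S →ₗ[ℝ] S :=
  LinearMap.mk₂ ℝ (fun v s => η.ι v • s)
    (fun v w s => by simp [add_smul])
    (fun c v s => by simp)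
    (fun v s t => by simp)
    (fun c v s => by rw [← algebraMap_smul η.Cl c s, ← algebraMap_smul η.Cl c (_ • s),
      ← mul_smul, ← mul_smul, Algebra.commutes])

/-- The symmetric bilinear map `κ : S × S → V` whose value `κ(s, s)` is the Dirac current of
`s`; it is determined by `η(κ(s, t), v) = ⟨s, v · t⟩` (see `form_kappa`). -/
def kappa : S →ₗ[ℝ] S →ₗ[ℝ] V :=
  ∑ i, lorentzSign i •
    ((ω.form.compl₂ (cliffordMul η S (η.basis i))).compr₂
      (LinearMap.toSpanSingleton ℝ V (η.basis i)))

theorem kappa_apply (s t : S) :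
    ω.kappa s t = ∑ i, (lorentzSign i * ω.form s (η.ι (η.basis i) • t)) • η.basis i := by
  simp [kappa, LinearMap.sum_apply, cliffordMul, smul_smul]

theorem form_kappa (s t : S) (v : V) :
    η.form (ω.kappa s t) v = ω.form s (η.ι v • t) := by
  have h : η.ι v • t = cliffordMul η S v t := rfl
  rw [h, kappa_apply]
  conv_rhs => rw [← η.sum_basis v]
  simp only [map_sum, map_smul, LinearMap.sum_apply, LinearMap.smul_apply, smul_eq_mul]
  refine Finset.sum_congr rfl fun i _ => ?_
  simp only [cliffordMul, LinearMap.mk₂_apply]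
  ring

theorem kappa_symm (s t : S) : ω.kappa s t = ω.kappa t s := by
  rw [kappa_apply, kappa_apply]
  exact Finset.sum_congr rfl fun i _ => by rw [ω.form_symm]

theorem form_sigma (A : ↥η.so) (s t : S) :
    ω.form (sigma η S A s) t = -ω.form s (sigma η S A t) := by
  have two : ∀ (x y : V) (s t : S),
      ω.form ((η.ι x * η.ι y) • s) t = ω.form s ((η.ι y * η.ι x) • t) := by
    intro x y s t
    rw [mul_smul, mul_smul, ω.clifford_skew, ω.clifford_skew, neg_neg]
  have r : ∀ u : S, sigma η S A u = (1 / 8 : ℝ) • ∑ i, lorentzSign i •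
      ((η.ι (η.basis i) * η.ι (A.1 (η.basis i))) • u -
        (η.ι (A.1 (η.basis i)) * η.ι (η.basis i)) • u) := by
    intro u
    rw [sigma_apply]
    simp only [LorentzForm.spin, LinearMap.coe_mk, AddHom.coe_mk, smul_assoc, Finset.sum_smul,
      sub_smul]
  rw [r, r]
  simp only [map_smul, map_sum, map_sub, LinearMap.smul_apply, LinearMap.sum_apply,
    LinearMap.sub_apply, two, smul_eq_mul]
  rw [← mul_neg, ← Finset.sum_neg_distrib]
  congr 1
  exact Finset.sum_congr rfl fun i _ => by ring

theorem sigma_ι (A : ↥η.so) (v : V) (s : S) :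
    sigma η S A (η.ι v • s) = η.ι v • sigma η S A s + η.ι (A.1 v) • s := by
  rw [sigma_apply, sigma_apply, ← η.spin_commutator_ι, sub_smul, mul_smul, mul_smul]
  abel

theorem sigma_lie (A B : ↥η.so) (s : S) :
    sigma η S ⁅A, B⁆ s = sigma η S A (sigma η S B s) - sigma η S B (sigma η S A s) := by
  simp only [sigma_apply]
  rw [η.spin_lie, sub_smul, mul_smul, mul_smul]

theorem kappa_equivariant (A : ↥η.so) (s t : S) :
    A.1 (ω.kappa s t) = ω.kappa (sigma η S A s) t + ω.kappa s (sigma η S A t) := by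
  have h : ∀ u : V, η.form (A.1 (ω.kappa s t)) u =
      η.form (ω.kappa (sigma η S A s) t + ω.kappa s (sigma η S A t)) u := by
    intro u
    rw [η.so_skew, map_add, LinearMap.add_apply, form_kappa, form_kappa, form_kappa,
      form_sigma, sigma_ι, map_add]
    ring
  rw [← η.sum_basis (A.1 (ω.kappa s t)), ← η.sum_basis (_ + _)]
  exact Finset.sum_congr rfl fun i _ => by rw [η.symm, h, η.symm]

end SpinorForm

/-! ### The Poincaré superalgebra -/

section Poincare

variable {V : Type*} [AddCommGroup V] [Module ℝ V] (η : LorentzForm V)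
  {S : Type*} [AddCommGroup S] [Module ℝ S] [Module η.Cl S] [IsScalarTower ℝ η.Cl S]

/-- The subspace of degree `i` of `V ⊕ S ⊕ so(V)`: it is `V`, `S`, `so(V)` for `i = -2, -1, 0`
and zero otherwise. -/
def poincareDeg (S : Type*) [AddCommGroup S] [Module ℝ S] (i : ℤ) :
    Submodule ℝ (V × S × ↥η.so) where
  carrier := {x | (i ≠ -2 → x.1 = 0) ∧ (i ≠ -1 → x.2.1 = 0) ∧ (i ≠ 0 → x.2.2 = 0)}
  add_mem' hx hy := ⟨fun h => by simp [hx.1 h, hy.1 h], fun h => by simp [hx.2.1 h, hy.2.1 h],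
    fun h => by simp [hx.2.2 h, hy.2.2 h]⟩
  zero_mem' := ⟨fun _ => rfl, fun _ => rfl, fun _ => rfl⟩
  smul_mem' c x hx := ⟨fun h => by simp [hx.1 h], fun h => by simp [hx.2.1 h],
    fun h => by simp [hx.2.2 h]⟩

/-- The even part `V ⊕ so(V)` and the odd part `S` of `V ⊕ S ⊕ so(V)`. -/
def poincarePart (S : Type*) [AddCommGroup S] [Module ℝ S] (e : ZMod 2) :
    Submodule ℝ (V × S × ↥η.so) where
  carrier := {x | (e ≠ 0 → x.1 = 0) ∧ (e ≠ 1 → x.2.1 = 0) ∧ (e ≠ 0 → x.2.2 = 0)}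
  add_mem' hx hy := ⟨fun h => by simp [hx.1 h, hy.1 h], fun h => by simp [hx.2.1 h, hy.2.1 h],
    fun h => by simp [hx.2.2 h, hy.2.2 h]⟩
  zero_mem' := ⟨fun _ => rfl, fun _ => rfl, fun _ => rfl⟩
  smul_mem' c x hx := ⟨fun h => by simp [hx.1 h], fun h => by simp [hx.2.1 h],
    fun h => by simp [hx.2.2 h]⟩

/-- The bracket of the Poincaré superalgebra: `[A, B] = AB - BA`, `[A, s] = σ(A)s`, `[A, v] = Av`
and `[s, t] = κ(s, t)`, the other brackets being zero. -/
def poincareBracket (ω : SpinorForm η S) :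
    (V × S × ↥η.so) →ₗ[ℝ] (V × S × ↥η.so) →ₗ[ℝ] (V × S × ↥η.so) :=
  LinearMap.mk₂ ℝ
    (fun x y => (x.2.2.1 y.1 - y.2.2.1 x.1 + ω.kappa x.2.1 y.2.1,
      SpinorForm.sigma η S x.2.2 y.2.1 - SpinorForm.sigma η S y.2.2 x.2.1, ⁅x.2.2, y.2.2⁆))
    (fun x x' y => by
      refine Prod.ext ?_ (Prod.ext ?_ ?_)
      · simp; abel
      · simp; abel
      · simp)
    (fun c x y => by
      refine Prod.ext ?_ (Prod.ext ?_ ?_) <;> simp [smul_sub])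
    (fun x y y' => by
      refine Prod.ext ?_ (Prod.ext ?_ ?_)
      · simp; abel
      · simp; abel
      · simp)
    (fun c x y => by
      refine Prod.ext ?_ (Prod.ext ?_ ?_) <;> simp [smul_sub])

theorem poincareBracket_apply (ω : SpinorForm η S) (x y : V × S × ↥η.so) :
    poincareBracket η ω x y =
      (x.2.2.1 y.1 - y.2.2.1 x.1 + ω.kappa x.2.1 y.2.1,
      SpinorForm.sigma η S x.2.2 y.2.1 - SpinorForm.sigma η S y.2.2 x.2.1, ⁅x.2.2, y.2.2⁆) := rfl

theorem poincareDeg_internal (S : Type*) [AddCommGroup S] [Module ℝ S] :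
    DirectSum.IsInternal (poincareDeg η S) := by
  refine DirectSum.isInternal_submodule_of_iSupIndep_of_iSup_eq_top ?_ ?_
  · intro i
    let N : Submodule ℝ (V × S × ↥η.so) :=
      { carrier := {x | (i = -2 → x.1 = 0) ∧ (i = -1 → x.2.1 = 0) ∧ (i = 0 → x.2.2 = 0)}
        add_mem' := fun hx hy => ⟨fun h => by simp [hx.1 h, hy.1 h],
          fun h => by simp [hx.2.1 h, hy.2.1 h], fun h => by simp [hx.2.2 h, hy.2.2 h]⟩
        zero_mem' := ⟨fun _ => rfl, fun _ => rfl, fun _ => rfl⟩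
        smul_mem' := fun c x hx => ⟨fun h => by simp [hx.1 h], fun h => by simp [hx.2.1 h],
          fun h => by simp [hx.2.2 h]⟩ }
    have hN : (⨆ j, ⨆ (_ : j ≠ i), poincareDeg η S j) ≤ N := by
      refine iSup_le fun j => iSup_le fun hj x hx => ?_
      exact ⟨fun h => hx.1 (h ▸ hj), fun h => hx.2.1 (h ▸ hj), fun h => hx.2.2 (h ▸ hj)⟩
    refine Disjoint.mono_right hN ?_
    rw [Submodule.disjoint_def]
    intro x hx hx'
    refine Prod.ext ?_ (Prod.ext ?_ ?_)
    · by_cases h : i = -2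
      · exact hx'.1 h
      · exact hx.1 h
    · by_cases h : i = -1
      · exact hx'.2.1 h
      · exact hx.2.1 h
    · by_cases h : i = 0
      · exact hx'.2.2 h
      · exact hx.2.2 h
  · refine eq_top_iff.2 fun x _ => ?_
    have e : x = (x.1, 0, 0) + (0, x.2.1, 0) + (0, 0, x.2.2) := by simp
    rw [e]
    refine add_mem (add_mem ?_ ?_) ?_
    · exact Submodule.mem_iSup_of_mem (-2) ⟨by simp, by simp, by simp⟩
    · exact Submodule.mem_iSup_of_mem (-1) ⟨by simp, by simp, by simp⟩
    · exact Submodule.mem_iSup_of_mem 0 ⟨by simp, by simp, by simp⟩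

theorem poincarePart_internal (S : Type*) [AddCommGroup S] [Module ℝ S] :
    DirectSum.IsInternal (poincarePart η S) := by
  refine DirectSum.isInternal_submodule_of_iSupIndep_of_iSup_eq_top ?_ ?_
  · intro i
    let N : Submodule ℝ (V × S × ↥η.so) :=
      { carrier := {x | (i = 0 → x.1 = 0) ∧ (i = 1 → x.2.1 = 0) ∧ (i = 0 → x.2.2 = 0)}
        add_mem' := fun hx hy => ⟨fun h => by simp [hx.1 h, hy.1 h],
          fun h => by simp [hx.2.1 h, hy.2.1 h], fun h => by simp [hx.2.2 h, hy.2.2 h]⟩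
        zero_mem' := ⟨fun _ => rfl, fun _ => rfl, fun _ => rfl⟩
        smul_mem' := fun c x hx => ⟨fun h => by simp [hx.1 h], fun h => by simp [hx.2.1 h],
          fun h => by simp [hx.2.2 h]⟩ }
    have hN : (⨆ j, ⨆ (_ : j ≠ i), poincarePart η S j) ≤ N := by
      refine iSup_le fun j => iSup_le fun hj x hx => ?_
      exact ⟨fun h => hx.1 (h ▸ hj), fun h => hx.2.1 (h ▸ hj), fun h => hx.2.2 (h ▸ hj)⟩
    refine Disjoint.mono_right hN ?_
    rw [Submodule.disjoint_def]
    intro x hx hx'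
    refine Prod.ext ?_ (Prod.ext ?_ ?_)
    · by_cases h : i = 0
      · exact hx'.1 h
      · exact hx.1 h
    · by_cases h : i = 1
      · exact hx'.2.1 h
      · exact hx.2.1 h
    · by_cases h : i = 0
      · exact hx'.2.2 h
      · exact hx.2.2 h
  · refine eq_top_iff.2 fun x _ => ?_
    have e : x = (x.1, 0, x.2.2) + (0, x.2.1, 0) := by simp
    rw [e]
    refine add_mem ?_ ?_
    · exact Submodule.mem_iSup_of_mem 0 ⟨by simp, by simp, by simp⟩
    · exact Submodule.mem_iSup_of_mem 1 ⟨by simp, by simp, by simp⟩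

theorem poincarePart_cases {e : ZMod 2} {x : V × S × ↥η.so} (hx : x ∈ poincarePart η S e) :
    (e = 0 ∧ ∃ v A, x = (v, 0, A)) ∨ (e = 1 ∧ ∃ s, x = (0, s, 0)) := by
  have he : e = 0 ∨ e = 1 := (by decide : ∀ e : ZMod 2, e = 0 ∨ e = 1) e
  obtain ⟨v, s, A⟩ := x
  obtain ⟨h1, h2, h3⟩ := hx
  rcases he with rfl | rfl
  · have hs : s = 0 := h2 (by decide)
    exact Or.inl ⟨rfl, v, A, by rw [hs]⟩
  · have hv : v = 0 := h1 (by decide)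
    have hA : A = 0 := h3 (by decide)
    exact Or.inr ⟨rfl, s, by rw [hv, hA]⟩

theorem mem_poincarePart_even (v : V) (A : ↥η.so) :
    ((v, 0, A) : V × S × ↥η.so) ∈ poincarePart η S 0 :=
  ⟨fun h => absurd rfl h, fun _ => rfl, fun h => absurd rfl h⟩

theorem mem_poincarePart_odd (s : S) :
    ((0, s, 0) : V × S × ↥η.so) ∈ poincarePart η S 1 :=
  ⟨fun _ => rfl, fun h => absurd rfl h, fun _ => rfl⟩

theorem superSign_zero_left (e : ZMod 2) : superSign 0 e = 1 := by simp [superSign]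

theorem superSign_zero_right (e : ZMod 2) : superSign e 0 = 1 := by simp [superSign]

theorem superSign_one_one : superSign 1 1 = -1 := by
  simp [superSign, ZMod.val_one]

section brackets

variable (ω : SpinorForm η S)

theorem bracket_even_even (v w : V) (A B : ↥η.so) :
    poincareBracket η ω (v, 0, A) (w, 0, B) = (A.1 w - B.1 v, 0, ⁅A, B⁆) := by
  simp [poincareBracket_apply]

theorem bracket_even_odd (v : V) (A : ↥η.so) (s : S) :
    poincareBracket η ω (v, 0, A) (0, s, 0) = (0, SpinorForm.sigma η S A s, 0) := by
  simp [poincareBracket_apply]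

theorem bracket_odd_even (v : V) (A : ↥η.so) (s : S) :
    poincareBracket η ω (0, s, 0) (v, 0, A) = (0, -SpinorForm.sigma η S A s, 0) := by
  simp [poincareBracket_apply]

theorem bracket_odd_odd (s t : S) :
    poincareBracket η ω (0, s, 0) (0, t, 0) = (ω.kappa s t, 0, 0) := by
  simp [poincareBracket_apply]

end brackets

theorem poincareBracket_mem (ω : SpinorForm η S) {i j : ZMod 2} {x y : V × S × ↥η.so}
    (hx : x ∈ poincarePart η S i) (hy : y ∈ poincarePart η S j) :
    poincareBracket η ω x y ∈ poincarePart η S (i + j) := by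
  rcases poincarePart_cases η hx with ⟨rfl, v, A, rfl⟩ | ⟨rfl, s, rfl⟩ <;>
    rcases poincarePart_cases η hy with ⟨rfl, w, B, rfl⟩ | ⟨rfl, t, rfl⟩
  · rw [bracket_even_even]
    exact mem_poincarePart_even η _ _
  · rw [bracket_even_odd, zero_add]
    exact mem_poincarePart_odd η _
  · rw [bracket_odd_even, add_zero]
    exact mem_poincarePart_odd η _
  · rw [bracket_odd_odd, show (1 + 1 : ZMod 2) = 0 by decide]
    exact mem_poincarePart_even η _ _

theorem poincareBracket_skew (ω : SpinorForm η S) {i j : ZMod 2} {x y : V × S × ↥η.so}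
    (hx : x ∈ poincarePart η S i) (hy : y ∈ poincarePart η S j) :
    poincareBracket η ω x y = -(superSign i j • poincareBracket η ω y x) := by
  rcases poincarePart_cases η hx with ⟨rfl, v, A, rfl⟩ | ⟨rfl, s, rfl⟩ <;>
    rcases poincarePart_cases η hy with ⟨rfl, w, B, rfl⟩ | ⟨rfl, t, rfl⟩
  · simp [bracket_even_even, superSign_zero_left]
  · simp [bracket_even_odd, bracket_odd_even, superSign_zero_left]
  · simp [bracket_even_odd, bracket_odd_even, superSign_zero_right]
  · simp [bracket_odd_odd, superSign_one_one, ω.kappa_symm s t]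

theorem poincareBracket_jacobi (ω : SpinorForm η S) {i j k : ZMod 2} {x y z : V × S × ↥η.so}
    (hx : x ∈ poincarePart η S i) (hy : y ∈ poincarePart η S j) (hz : z ∈ poincarePart η S k) :
    poincareBracket η ω x (poincareBracket η ω y z) =
      poincareBracket η ω (poincareBracket η ω x y) z +
        superSign i j • poincareBracket η ω y (poincareBracket η ω x z) := by
  have br : ∀ (A B : ↥η.so) (v : V), (⁅A, B⁆ : ↥η.so).1 v = A.1 (B.1 v) - B.1 (A.1 v) :=
    fun _ _ _ => rfl
  rcases poincarePart_cases η hx with ⟨rfl, v, A, rfl⟩ | ⟨rfl, s, rfl⟩ <;>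
    rcases poincarePart_cases η hy with ⟨rfl, w, B, rfl⟩ | ⟨rfl, t, rfl⟩ <;>
    rcases poincarePart_cases η hz with ⟨rfl, u, C, rfl⟩ | ⟨rfl, r, rfl⟩
  · simp only [bracket_even_even, superSign_zero_left, one_smul]
    refine Prod.ext ?_ (Prod.ext ?_ ?_)
    · simp only [Prod.fst_add, br, map_sub]
      abel
    · simp
    · exact leibniz_lie A B C
  · simp only [bracket_even_even, bracket_even_odd, superSign_zero_left, one_smul,
      SpinorForm.sigma_lie]
    simp
  · simp only [bracket_even_even, bracket_even_odd, bracket_odd_even, superSign_zero_left,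
      one_smul, SpinorForm.sigma_lie]
    simp
    abel
  · simp only [bracket_even_even, bracket_even_odd, bracket_odd_odd, superSign_zero_left,
      one_smul]
    simp [ω.kappa_equivariant]
  · simp only [bracket_even_even, bracket_even_odd, bracket_odd_even, superSign_zero_right,
      one_smul, SpinorForm.sigma_lie]
    simp
    abel
  · simp only [bracket_even_even, bracket_even_odd, bracket_odd_even, bracket_odd_odd,
      superSign_zero_right, one_smul]
    simp [ω.kappa_equivariant]
  · simp only [bracket_odd_even, bracket_odd_odd, bracket_even_even, superSign_one_one]
    simp [ω.kappa_equivariant, ω.kappa_symm t]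
  · simp only [bracket_even_odd, bracket_odd_even, bracket_odd_odd, superSign_one_one]
    simp

/-- The `N = 1` Poincaré superalgebra `V ⊕ S ⊕ so(V)`. -/
def poincare (ω : SpinorForm η S) : GradedLieSuperalgebra (V × S × ↥η.so) where
  part := poincarePart η S
  part_internal := poincarePart_internal η S
  bracket := poincareBracket η ω
  bracket_mem := poincareBracket_mem η ω
  skew := poincareBracket_skew η ω
  jacobi := poincareBracket_jacobi η ω
  deg := poincareDeg η S
  deg_internal := poincareDeg_internal η S
  deg_bracket_mem := by
    rintro i j ⟨v, s, A⟩ ⟨w, t, B⟩ ⟨h1, h2, h3⟩ ⟨k1, k2, k3⟩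
    dsimp only at h1 h2 h3 k1 k2 k3
    rw [poincareBracket_apply]
    refine ⟨fun h => ?_, fun h => ?_, fun h => ?_⟩ <;> dsimp only at h ⊢
    · have e1 : A.1 w = 0 := by
        by_cases hi : i = 0
        · rw [k1 (by omega), map_zero]
        · simp [h3 hi]
      have e2 : B.1 v = 0 := by
        by_cases hi : j = 0
        · rw [h1 (by omega), map_zero]
        · simp [k3 hi]
      have e3 : ω.kappa s t = 0 := by
        by_cases hi : i = -1
        · rw [k2 (by omega), map_zero]
        · simp [h2 hi]
      simp [e1, e2, e3]
    · have e1 : SpinorForm.sigma η S A t = 0 := by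
        by_cases hi : i = 0
        · rw [k2 (by omega), map_zero]
        · simp [h3 hi]
      have e2 : SpinorForm.sigma η S B s = 0 := by
        by_cases hi : j = 0
        · rw [h2 (by omega), map_zero]
        · simp [k3 hi]
      simp [e1, e2]
    · by_cases hi : i = 0
      · rw [k3 (by omega), lie_zero]
      · rw [h3 hi, zero_lie]
  deg_le_part := by
    rintro i ⟨v, s, A⟩ ⟨h1, h2, h3⟩
    refine ⟨fun h => h1 ?_, fun h => h2 ?_, fun h => h3 ?_⟩
    · rintro rfl
      exact h (by decide)
    · rintro rfl
      exact h (by decide)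
    · rintro rfl
      exact h (by decide)

end Poincare

end

/-!
If two brackets on the vector space of `a` both deform its bracket, then the lowest-degree
component of their difference is a Chevalley–Eilenberg `2`-cocycle of `a` with values in the
adjoint representation. Parity excludes odd degrees, so the degree `2` component `μ` of a
deformed bracket is such a cocycle, defined on all of `a` and not only on `a₋`; the cocycle
identity with one argument `A` of degree `0` says that `A · μ` is the coboundary of the cochain
`μ(A, -)`, whence the invariance of the class.

Replacing an adapted identification `Θ` by `Θ ∘ (1 + f)` with `f` of degree `2` adds `∂f` to `μ`.
So if the classes agree, then one may assume that the restrictions of `μ` and `μ'` to `a₋` agree.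
In the Poincaré case an element of degree `0` that annihilates the spinors is zero, and this
forces every even cocycle of positive degree that vanishes on `a₋` to be zero; comparing the two
brackets degree by degree, they coincide.
-/

noncomputable section

section Bilinear

variable {R M N P : Type*} [CommRing R] [AddCommGroup M] [Module R M] [AddCommGroup N] [Module R N]
  [AddCommGroup P] [Module R P]

theorem bilin_mem_of_mem_iSup {ι κ : Sort*} {p : ι → Submodule R M} {q : κ → Submodule R N}
    {r : Submodule R P} (B : M →ₗ[R] N →ₗ[R] P)
    (h : ∀ i j, ∀ x ∈ p i, ∀ y ∈ q j, B x y ∈ r) {x : M} {y : N}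
    (hx : x ∈ ⨆ i, p i) (hy : y ∈ ⨆ j, q j) : B x y ∈ r := by
  have hle : Submodule.map₂ B (⨆ i, p i) (⨆ j, q j) ≤ r := by
    simp only [Submodule.map₂_iSup_left, Submodule.map₂_iSup_right, iSup_le_iff]
    exact fun j i => Submodule.map₂_le.2 (h i j)
  exact hle (Submodule.apply_mem_map₂ B hx hy)

theorem bilin_eq_zero_of_mem_iSup {ι κ : Sort*} {p : ι → Submodule R M}
    {q : κ → Submodule R N} (B : M →ₗ[R] N →ₗ[R] P)
    (h : ∀ i j, ∀ x ∈ p i, ∀ y ∈ q j, B x y = 0) {x : M} {y : N}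
    (hx : x ∈ ⨆ i, p i) (hy : y ∈ ⨆ j, q j) : B x y = 0 :=
  bilin_mem_of_mem_iSup (r := ⊥) B h hx hy

/-- Bilinear maps of degree `d` with respect to a family `F` of submodules; `F` will be a grading
or the filtration attached to it. -/
def bilinOfDegree (F : ℤ → Submodule R M) (d : ℤ) : Submodule R (M →ₗ[R] M →ₗ[R] M) where
  carrier := {B | ∀ ⦃i j x y⦄, x ∈ F i → y ∈ F j → B x y ∈ F (i + j + d)}
  add_mem' hB hC _ _ _ _ hx hy := add_mem (hB hx hy) (hC hx hy)
  zero_mem' _ _ _ _ _ _ := zero_mem _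
  smul_mem' c _ hB _ _ _ _ hx hy := Submodule.smul_mem _ c (hB hx hy)

/-- The polarised Jacobi expression `B(x, C(y, z)) - B(C(x, y), z) - c B(y, C(x, z))`, where `c`
stands for the sign attached to the parities of `x` and `y`. -/
def jacobiator (c : R) (B C : M →ₗ[R] M →ₗ[R] M) : M →ₗ[R] M →ₗ[R] M →ₗ[R] M :=
  LinearMap.mk₂ R (fun x y => B x ∘ₗ C y - B (C x y) - c • B y ∘ₗ C x)
    (fun x x' y => by ext; simp; module) (fun r x y => by ext; simp; module)
    (fun x y y' => by ext; simp; module) (fun r x y => by ext; simp; module)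

theorem jacobiator_apply (c : R) (B C : M →ₗ[R] M →ₗ[R] M) (x y z : M) :
    jacobiator c B C x y z = B x (C y z) - B (C x y) z - c • B y (C x z) := rfl

theorem jacobiator_mem {F : ℤ → Submodule R M} {m n : ℤ} {B C : M →ₗ[R] M →ₗ[R] M}
    (hB : B ∈ bilinOfDegree F m) (hC : C ∈ bilinOfDegree F n) (c : R) {i j k : ℤ} {x y z : M}
    (hx : x ∈ F i) (hy : y ∈ F j) (hz : z ∈ F k) :
    jacobiator c B C x y z ∈ F (i + j + k + (m + n)) := by
  have hxyz := hB hx (hC hy hz)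
  have hxy_z := hB (hC hx hy) hz
  have hyxz := hB hy (hC hx hz)
  rw [show i + (j + k + n) + m = i + j + k + (m + n) by ring] at hxyz
  rw [show i + j + n + k + m = i + j + k + (m + n) by ring] at hxy_z
  rw [show j + (i + k + n) + m = i + j + k + (m + n) by ring] at hyxz
  exact sub_mem (sub_mem hxyz hxy_z) (Submodule.smul_mem _ c hyxz)

end Bilinear

namespace LieSuperalgebra

variable {L : Type*} [AddCommGroup L] [Module ℝ L] (g : LieSuperalgebra L)

theorem mem_part_iff_of_map_part {K : Type*} [AddCommGroup K] [Module ℝ K]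
    (a : LieSuperalgebra K) (f : K ≃ₗ[ℝ] L) (hf : ∀ e x, x ∈ a.part e → f x ∈ g.part e)
    {e : ZMod 2} {x : K} : f x ∈ g.part e ↔ x ∈ a.part e := by
  have hmap : (fun e => (a.part e).map f.toLinearMap) = g.part := by
    refine (g.part_internal.submodule_iSupIndep.le_iff_eq_of_iSup_eq_top ?_).1 fun e =>
      Submodule.map_le_iff_le_comap.2 (hf e)
    rw [← Submodule.map_iSup, a.part_internal.submodule_iSup_eq_top, Submodule.map_top,
      LinearEquiv.range]
  rw [← congrFun hmap e]
  exact f.injective.mem_set_image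

/-- The even bilinear maps `L × L → L` that are skew-symmetric in the super sense. -/
def evenSkewMaps : Submodule ℝ (L →ₗ[ℝ] L →ₗ[ℝ] L) where
  carrier := {B | ∀ ⦃i j x y⦄, x ∈ g.part i → y ∈ g.part j →
    B x y ∈ g.part (i + j) ∧ B x y = -(superSign i j • B y x)}
  add_mem' hB hC i j x y hx hy := by
    refine ⟨add_mem (hB hx hy).1 (hC hx hy).1, ?_⟩
    simp only [LinearMap.add_apply]
    rw [(hB hx hy).2, (hC hx hy).2]
    module
  zero_mem' _ _ _ _ _ _ := by simp
  smul_mem' c B hB i j x y hx hy := by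
    refine ⟨Submodule.smul_mem _ c (hB hx hy).1, ?_⟩
    simp only [LinearMap.smul_apply]
    rw [(hB hx hy).2]
    module

theorem bracket_mem_evenSkewMaps : g.bracket ∈ g.evenSkewMaps :=
  fun _ _ _ _ hx hy => ⟨g.bracket_mem hx hy, g.skew hx hy⟩

theorem jacobiator_bracket {i j : ZMod 2} {x y : L} (hx : x ∈ g.part i) (hy : y ∈ g.part j) :
    jacobiator (superSign i j) g.bracket g.bracket x y = 0 := by
  refine LinearMap.ext fun z => ?_
  have hz : z ∈ ⨆ k, g.part k := g.part_internal.submodule_iSup_eq_top ▸ Submodule.mem_top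
  refine (iSup_le fun k z hz => ?_ : ⨆ k, g.part k ≤ LinearMap.ker _) hz
  rw [LinearMap.mem_ker, jacobiator_apply, g.jacobi hx hy hz]
  abel

end LieSuperalgebra

namespace GradedLieSuperalgebra

variable {K : Type*} [AddCommGroup K] [Module ℝ K] (a : GradedLieSuperalgebra K)

theorem proj_mem (i : ℤ) (x : K) : a.proj i x ∈ a.deg i := Subtype.prop _

theorem proj_of_mem {i : ℤ} {x : K} (hx : x ∈ a.deg i) : a.proj i x = x := by
  simp [proj, a.decomp_of_mem hx, DirectSum.component.lof_self]

theorem proj_of_mem_ne {i j : ℤ} (hij : i ≠ j) {x : K} (hx : x ∈ a.deg i) : a.proj j x = 0 := by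
  simp [proj, a.decomp_of_mem hx, DirectSum.component.of, hij]

theorem mem_of_proj_mem {p : Submodule ℝ K} {x : K} (h : ∀ i, a.proj i x ∈ p) : x ∈ p := by
  classical
  have hx : DirectSum.coeLinearMap a.deg (a.decomp x) = x := a.decomp.symm_apply_apply x
  rw [← hx, DirectSum.coeLinearMap_eq_dfinsuppSum]
  exact dfinsuppSum_mem _ _ _ fun i _ => h i

theorem mem_iSup_deg (x : K) : x ∈ ⨆ i, a.deg i :=
  a.deg_internal.submodule_iSup_eq_top ▸ Submodule.mem_top

theorem part_eq_iSup_deg (e : ZMod 2) :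
    a.part e = ⨆ i : {i : ℤ // (i : ZMod 2) = e}, a.deg i := by
  have hle : ∀ e, ⨆ i : {i : ℤ // (i : ZMod 2) = e}, a.deg i ≤ a.part e :=
    fun e => iSup_le fun ⟨i, hi⟩ => hi ▸ a.deg_le_part i
  refine (congrFun ((a.part_internal.submodule_iSupIndep.le_iff_eq_of_iSup_eq_top ?_).1 hle)
    e).symm
  refine eq_top_iff.2 fun x _ => (iSup_le fun i => ?_ : ⨆ i, a.deg i ≤ _) (a.mem_iSup_deg x)
  exact le_iSup_of_le (i : ZMod 2) (le_iSup_of_le ⟨i, rfl⟩ le_rfl)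

theorem proj_eq_zero_of_mem_part {e : ZMod 2} {x : K} (hx : x ∈ a.part e) {i : ℤ}
    (hi : (i : ZMod 2) ≠ e) : a.proj i x = 0 := by
  rw [part_eq_iSup_deg] at hx
  refine (iSup_le fun j y hy => ?_ : _ ≤ LinearMap.ker (a.proj i)) hx
  exact a.proj_of_mem_ne (by rintro rfl; exact hi j.2) hy

/-- The decreasing filtration `⨁_{j ≥ i} a_j` attached to the grading. -/
def filt (i : ℤ) : Submodule ℝ K := ⨆ j : {j : ℤ // i ≤ j}, a.deg j

theorem deg_le_filt {i j : ℤ} (hij : i ≤ j) : a.deg j ≤ a.filt i :=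
  le_iSup (fun j : {j : ℤ // i ≤ j} => a.deg j) ⟨j, hij⟩

theorem mem_filt_iff {i : ℤ} {x : K} : x ∈ a.filt i ↔ ∀ j < i, a.proj j x = 0 := by
  refine ⟨fun hx j hj => ?_, fun h => a.mem_of_proj_mem fun j => ?_⟩
  · refine (iSup_le fun k y hy => ?_ : a.filt i ≤ LinearMap.ker (a.proj j)) hx
    exact a.proj_of_mem_ne (hj.trans_le k.2).ne' hy
  · rcases lt_or_ge j i with hj | hj
    · rw [h j hj]
      exact zero_mem _
    · exact a.deg_le_filt hj (a.proj_mem j x)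

theorem filt_antitone : Antitone a.filt := fun _ _ hij _ hx =>
  a.mem_filt_iff.2 fun k hk => a.mem_filt_iff.1 hx k (hk.trans_le hij)

theorem mem_filt_succ_iff {i : ℤ} {x : K} :
    x ∈ a.filt (i + 1) ↔ x ∈ a.filt i ∧ a.proj i x = 0 := by
  simp only [mem_filt_iff, Int.lt_add_one_iff]
  refine ⟨fun h => ⟨fun j hj => h j hj.le, h i le_rfl⟩, fun h j hj => ?_⟩
  rcases hj.lt_or_eq with hj | rfl
  exacts [h.1 j hj, h.2]

theorem exists_mem_filt (x : K) : ∃ i, x ∈ a.filt i := by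
  refine Submodule.iSup_induction _ (motive := fun x => ∃ i, x ∈ a.filt i) (a.mem_iSup_deg x)
    (fun i x hx => ⟨i, a.deg_le_filt le_rfl hx⟩) ⟨0, zero_mem _⟩ ?_
  rintro x y ⟨i, hx⟩ ⟨j, hy⟩
  exact ⟨min i j, add_mem (a.filt_antitone (min_le_left i j) hx)
    (a.filt_antitone (min_le_right i j) hy)⟩

theorem eq_zero_of_forall_mem_filt {x : K} (h : ∀ i, x ∈ a.filt i) : x = 0 := by
  refine (Submodule.mem_bot ℝ).1 (a.mem_of_proj_mem fun i => ?_)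
  exact (Submodule.mem_bot ℝ).2 (a.mem_filt_succ_iff.1 (h (i + 1))).2

theorem eq_zero_of_mem_deg_of_mem_filt {i : ℤ} {x : K} (hx : x ∈ a.deg i)
    (hx' : x ∈ a.filt (i + 1)) : x = 0 :=
  (a.proj_of_mem hx).symm.trans (a.mem_filt_succ_iff.1 hx').2

/-- The grading is concentrated in the degrees belonging to `s`. -/
def SupportedIn (s : Set ℤ) : Prop := ∀ i ∉ s, a.deg i = ⊥

variable {a} in
theorem SupportedIn.eq_zero {s : Set ℤ} (hs : a.SupportedIn s) {i : ℤ} (hi : i ∉ s) {x : K}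
    (hx : x ∈ a.deg i) : x = 0 :=
  (Submodule.mem_bot ℝ).1 (hs i hi ▸ hx)

variable {a} in
theorem SupportedIn.mono {s t : Set ℤ} (hs : a.SupportedIn s) (hst : s ⊆ t) : a.SupportedIn t :=
  fun i hi => hs i fun his => hi (hst his)

theorem linearMap_ext_deg {M : Type*} [AddCommGroup M] [Module ℝ M] {f g : K →ₗ[ℝ] M}
    (h : ∀ {i}, ∀ x ∈ a.deg i, f x = g x) : f = g :=
  LinearMap.ext fun x =>
    (iSup_le fun _ x hx => h x hx : ⨆ i, a.deg i ≤ LinearMap.eqLocus f g) (a.mem_iSup_deg x)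

variable {a} in
theorem SupportedIn.linearMap_ext {M : Type*} [AddCommGroup M] [Module ℝ M] {s : Set ℤ}
    (hs : a.SupportedIn s) {f g : K →ₗ[ℝ] M}
    (h : ∀ {i}, i ∈ s → ∀ x ∈ a.deg i, f x = g x) : f = g := by
  refine a.linearMap_ext_deg fun {i} x hx => ?_
  by_cases hi : i ∈ s
  · exact h hi x hx
  · rw [hs.eq_zero hi hx, map_zero, map_zero]

theorem mem_bilinOfDegree_filt_iff {d : ℤ} {B : K →ₗ[ℝ] K →ₗ[ℝ] K} :
    B ∈ bilinOfDegree a.filt d ↔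
      ∀ {i j x y}, x ∈ a.deg i → y ∈ a.deg j → B x y ∈ a.filt (i + j + d) := by
  refine ⟨fun h _ _ _ _ hx hy => h (a.deg_le_filt le_rfl hx) (a.deg_le_filt le_rfl hy),
    fun h i j x y hx hy => bilin_mem_of_mem_iSup B (fun m n x hx y hy => ?_) hx hy⟩
  exact a.filt_antitone (by linarith [m.2, n.2]) (h hx hy)

theorem bilinOfDegree_deg_le_filt (d : ℤ) : bilinOfDegree a.deg d ≤ bilinOfDegree a.filt d :=
  fun _ hB => a.mem_bilinOfDegree_filt_iff.2 fun hx hy => a.deg_le_filt le_rfl (hB hx hy)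

theorem bilinOfDegree_filt_antitone : Antitone (bilinOfDegree a.filt) :=
  fun _ _ hde _ hB _ _ _ _ hx hy => a.filt_antitone (by linarith) (hB hx hy)

theorem bracket_mem_bilinOfDegree : a.bracket ∈ bilinOfDegree a.deg 0 := fun _ _ _ _ hx hy => by
  rw [add_zero]
  exact a.deg_bracket_mem hx hy

theorem bilin_ext_deg {M : Type*} [AddCommGroup M] [Module ℝ M] {B C : K →ₗ[ℝ] K →ₗ[ℝ] M}
    (h : ∀ {i j x y}, x ∈ a.deg i → y ∈ a.deg j → B x y = C x y) : B = C := by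
  refine LinearMap.ext₂ fun x y => sub_eq_zero.1 (bilin_eq_zero_of_mem_iSup (B - C)
    (fun i j x hx y hy => sub_eq_zero.2 (h hx hy)) (a.mem_iSup_deg x) (a.mem_iSup_deg y))

theorem bilin_eq_zero_of_mem_part {M : Type*} [AddCommGroup M] [Module ℝ M]
    {B : K →ₗ[ℝ] K →ₗ[ℝ] M} {i j : ZMod 2}
    (h : ∀ {m n : ℤ} {x y}, (m : ZMod 2) = i → (n : ZMod 2) = j → x ∈ a.deg m → y ∈ a.deg n →
      B x y = 0) {x y : K} (hx : x ∈ a.part i) (hy : y ∈ a.part j) : B x y = 0 := by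
  rw [part_eq_iSup_deg] at hx hy
  exact bilin_eq_zero_of_mem_iSup B (fun m n x hx y hy => h m.2 n.2 hx hy) hx hy

theorem bilinComponent_mem (d : ℤ) (B : K →ₗ[ℝ] K →ₗ[ℝ] K) :
    a.bilinComponent d B ∈ bilinOfDegree a.deg d := fun _ _ _ _ hx hy => by
  rw [a.bilinComponent_apply d B hx hy]
  exact a.proj_mem _ _

theorem bilinComponent_sub (d : ℤ) (B C : K →ₗ[ℝ] K →ₗ[ℝ] K) :
    a.bilinComponent d (B - C) = a.bilinComponent d B - a.bilinComponent d C :=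
  a.bilin_ext_deg fun hx hy => by
    simp only [a.bilinComponent_apply d _ hx hy, LinearMap.sub_apply, map_sub]

theorem bilinComponent_of_mem {d : ℤ} {B : K →ₗ[ℝ] K →ₗ[ℝ] K} (hB : B ∈ bilinOfDegree a.deg d) :
    a.bilinComponent d B = B :=
  a.bilin_ext_deg fun hx hy => by
    rw [a.bilinComponent_apply d B hx hy, a.proj_of_mem (hB hx hy)]

theorem mem_bilinOfDegree_filt_succ_iff {d : ℤ} {B : K →ₗ[ℝ] K →ₗ[ℝ] K} :
    B ∈ bilinOfDegree a.filt (d + 1) ↔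
      B ∈ bilinOfDegree a.filt d ∧ a.bilinComponent d B = 0 := by
  refine ⟨fun h => ⟨a.bilinOfDegree_filt_antitone (by linarith) h, a.bilin_ext_deg ?_⟩,
    fun h => a.mem_bilinOfDegree_filt_iff.2 fun {i j x y} hx hy => ?_⟩
  · intro i j x y hx hy
    have hxy := a.mem_bilinOfDegree_filt_iff.1 h hx hy
    rw [← add_assoc, mem_filt_succ_iff] at hxy
    rw [a.bilinComponent_apply d B hx hy, hxy.2]
    rfl
  · rw [← add_assoc, mem_filt_succ_iff, ← a.bilinComponent_apply d B hx hy, h.2]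
    exact ⟨a.mem_bilinOfDegree_filt_iff.1 h.1 hx hy, rfl⟩

theorem sub_bilinComponent_mem {d : ℤ} {B : K →ₗ[ℝ] K →ₗ[ℝ] K}
    (hB : B ∈ bilinOfDegree a.filt d) :
    B - a.bilinComponent d B ∈ bilinOfDegree a.filt (d + 1) := by
  have hcomp := a.bilinComponent_mem d B
  refine a.mem_bilinOfDegree_filt_succ_iff.2
    ⟨sub_mem hB (a.bilinOfDegree_deg_le_filt d hcomp), ?_⟩
  rw [bilinComponent_sub, a.bilinComponent_of_mem hcomp, sub_self]

theorem bilinComponent_eq_zero_of_odd {d : ℤ} (hd : Odd d) {B : K →ₗ[ℝ] K →ₗ[ℝ] K}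
    (hB : B ∈ a.evenSkewMaps) : a.bilinComponent d B = 0 :=
  a.bilin_ext_deg fun {i j x y} hx hy => by
    have hxy := (hB (a.deg_le_part i hx) (a.deg_le_part j hy)).1
    have hd' : (d : ZMod 2) = 1 := (ZMod.intCast_eq_one_iff_odd).2 hd
    rw [a.bilinComponent_apply d B hx hy, a.proj_eq_zero_of_mem_part hxy (by simp [hd'])]
    rfl

theorem bilinComponent_mem_evenSkewMaps (d : ℤ) {B : K →ₗ[ℝ] K →ₗ[ℝ] K}
    (hB : B ∈ a.evenSkewMaps) : a.bilinComponent d B ∈ a.evenSkewMaps := by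
  rcases Int.even_or_odd d with hd | hd
  swap
  · rw [a.bilinComponent_eq_zero_of_odd hd hB]
    exact zero_mem _
  have hd' : (d : ZMod 2) = 0 := (ZMod.intCast_eq_zero_iff_even).2 hd
  refine fun i j x y hx hy => ⟨?_, ?_⟩
  · rw [part_eq_iSup_deg] at hx hy
    refine bilin_mem_of_mem_iSup _ (fun m n x hx y hy => ?_) hx hy
    have hxy := a.deg_le_part _ (a.bilinComponent_mem d B hx hy)
    rwa [Int.cast_add, Int.cast_add, m.2, n.2, hd', add_zero] at hxy
  · refine eq_neg_of_add_eq_zero_left (a.bilin_eq_zero_of_mem_part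
      (B := a.bilinComponent d B + superSign i j • (a.bilinComponent d B).flip) ?_ hx hy)
    rintro m n x y rfl rfl hx hy
    simp only [LinearMap.add_apply, LinearMap.smul_apply, LinearMap.flip_apply]
    rw [a.bilinComponent_apply d B hx hy, a.bilinComponent_apply d B hy hx, add_comm n m,
      (hB (a.deg_le_part m hx) (a.deg_le_part n hy)).2, map_neg, map_smul, neg_add_cancel]

/-! ### Leading terms of deformed brackets -/

variable {a}

variable (a) in
/-- The bilinear maps `P` that are even `2`-cocycles of `a` with values in the adjoint
representation; this is the condition that `[-,-] + t P` satisfies the Jacobi identity to first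
order in `t`. -/
structure IsCocycle (P : K →ₗ[ℝ] K →ₗ[ℝ] K) : Prop where
  mem_evenSkewMaps : P ∈ a.evenSkewMaps
  jacobiator_add : ∀ {i j : ZMod 2} {x y : K}, x ∈ a.part i → y ∈ a.part j →
    jacobiator (superSign i j) a.bracket P x y + jacobiator (superSign i j) P a.bracket x y = 0

variable (a) in
/-- The Lie superalgebra brackets `B` on the vector space of `a` that preserve the filtration
attached to the grading and induce the bracket of `a` on the associated graded space. -/
structure IsDeformation (B : K →ₗ[ℝ] K →ₗ[ℝ] K) : Prop where
  mem_evenSkewMaps : B ∈ a.evenSkewMaps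
  jacobiator_self : ∀ {i j : ZMod 2} {x y : K}, x ∈ a.part i → y ∈ a.part j →
    jacobiator (superSign i j) B B x y = 0
  sub_bracket_mem : B - a.bracket ∈ bilinOfDegree a.filt 1

variable (a) in
theorem isDeformation_bracket : a.IsDeformation a.bracket where
  mem_evenSkewMaps := a.bracket_mem_evenSkewMaps
  jacobiator_self := a.jacobiator_bracket
  sub_bracket_mem := by rw [sub_self]; exact zero_mem _

variable (a) in
theorem bracket_mem_bilinOfDegree_filt : a.bracket ∈ bilinOfDegree a.filt 0 :=
  a.bilinOfDegree_deg_le_filt 0 a.bracket_mem_bilinOfDegree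

theorem IsDeformation.mem_bilinOfDegree_filt {B : K →ₗ[ℝ] K →ₗ[ℝ] K} (hB : a.IsDeformation B) :
    B ∈ bilinOfDegree a.filt 0 := by
  simpa using add_mem (a.bilinOfDegree_filt_antitone zero_le_one hB.sub_bracket_mem)
    a.bracket_mem_bilinOfDegree_filt

/-- Up to terms of higher degree, the Jacobi identities of `B` and `B'` subtract to the cocycle
identity of the leading term of `B' - B`. -/
theorem jacobiator_bilinComponent_add_mem {B B' : K →ₗ[ℝ] K →ₗ[ℝ] K} (hB : a.IsDeformation B)
    (hB' : a.IsDeformation B') {d : ℤ} (hd : B' - B ∈ bilinOfDegree a.filt d)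
    {i j k : ℤ} {x y z : K} (hx : x ∈ a.deg i) (hy : y ∈ a.deg j) (hz : z ∈ a.deg k) :
    jacobiator (superSign i j) a.bracket (a.bilinComponent d (B' - B)) x y z +
      jacobiator (superSign i j) (a.bilinComponent d (B' - B)) a.bracket x y z ∈
        a.filt (i + j + k + (d + 1)) := by
  set c := superSign i j
  set F := B' - B with hF
  set F₀ := a.bilinComponent d F
  have hF₀ : F₀ ∈ bilinOfDegree a.filt d :=
    a.bilinOfDegree_deg_le_filt d (a.bilinComponent_mem d F)
  have hF₁ : F - F₀ ∈ bilinOfDegree a.filt (d + 1) := a.sub_bilinComponent_mem hd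
  have hjac : ∀ {m n : ℤ} {P Q : K →ₗ[ℝ] K →ₗ[ℝ] K}, P ∈ bilinOfDegree a.filt m →
      Q ∈ bilinOfDegree a.filt n → m + n = d + 1 →
        jacobiator c P Q x y z ∈ a.filt (i + j + k + (d + 1)) := fun hP hQ hmn =>
    hmn ▸ jacobiator_mem hP hQ c (a.deg_le_filt le_rfl hx) (a.deg_le_filt le_rfl hy)
      (a.deg_le_filt le_rfl hz)
  have hsum : jacobiator c a.bracket F₀ x y z + jacobiator c F₀ a.bracket x y z =
      jacobiator c B' B' x y z - jacobiator c B B x y z -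
        (jacobiator c (F - F₀) B' x y z + jacobiator c F₀ (B' - a.bracket) x y z +
          jacobiator c (B - a.bracket) F x y z + jacobiator c a.bracket (F - F₀) x y z) := by
    simp only [jacobiator_apply, hF, LinearMap.sub_apply, map_sub]
    module
  rw [hsum, hB'.jacobiator_self (a.deg_le_part i hx) (a.deg_le_part j hy),
    hB.jacobiator_self (a.deg_le_part i hx) (a.deg_le_part j hy), sub_self, zero_sub]
  exact neg_mem (add_mem (add_mem (add_mem
    (hjac hF₁ hB'.mem_bilinOfDegree_filt (by ring)) (hjac hF₀ hB'.sub_bracket_mem (by ring)))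
    (hjac hB.sub_bracket_mem hd (by ring)))
    (hjac a.bracket_mem_bilinOfDegree_filt hF₁ (by ring)))

theorem isCocycle_bilinComponent_sub {B B' : K →ₗ[ℝ] K →ₗ[ℝ] K} (hB : a.IsDeformation B)
    (hB' : a.IsDeformation B') {d : ℤ} (hd : B' - B ∈ bilinOfDegree a.filt d) :
    a.IsCocycle (a.bilinComponent d (B' - B)) where
  mem_evenSkewMaps := a.bilinComponent_mem_evenSkewMaps d
    (sub_mem hB'.mem_evenSkewMaps hB.mem_evenSkewMaps)
  jacobiator_add {i j x y} hx hy := by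
    set P := a.bilinComponent d (B' - B)
    have hP : P ∈ bilinOfDegree a.deg d := a.bilinComponent_mem d _
    refine a.bilin_eq_zero_of_mem_part (B := jacobiator (superSign i j) a.bracket P +
      jacobiator (superSign i j) P a.bracket) ?_ hx hy
    rintro m n x y rfl rfl hx hy
    refine a.linearMap_ext_deg fun z hz => ?_
    have hbP := jacobiator_mem a.bracket_mem_bilinOfDegree hP (superSign m n) hx hy hz
    have hPb := jacobiator_mem hP a.bracket_mem_bilinOfDegree (superSign m n) hx hy hz
    rw [zero_add] at hbP
    rw [add_zero] at hPb
    refine a.eq_zero_of_mem_deg_of_mem_filt (add_mem hbP hPb) ?_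
    rw [add_assoc _ d]
    exact jacobiator_bilinComponent_add_mem hB hB' hd hx hy hz

namespace IsCocycle

variable {P : K →ₗ[ℝ] K →ₗ[ℝ] K} (hP : a.IsCocycle P)

include hP

theorem apply_bracket_eq {i j : ZMod 2} {x y : K} (hx : x ∈ a.part i) (hy : y ∈ a.part j)
    (z : K) :
    P (a.bracket x y) z = a.bracket x (P y z) - a.bracket (P x y) z -
      superSign i j • a.bracket y (P x z) + P x (a.bracket y z) -
        superSign i j • P y (a.bracket x z) := by
  have h := LinearMap.congr_fun (hP.jacobiator_add hx hy) z
  simp only [LinearMap.add_apply, jacobiator_apply, LinearMap.zero_apply] at h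
  rw [← sub_eq_zero, ← neg_eq_zero, ← h]
  module

theorem domRestrict_mem_cocycles₂ {d : ℤ} (hd : P ∈ bilinOfDegree a.deg d) :
    P.domRestrict₁₂ a.neg a.neg ∈ a.cocycles₂ d := by
  refine ⟨⟨fun i j x y hx hy => hd hx hy, fun i j x y hx hy => (hP.mem_evenSkewMaps hx hy).2⟩,
    fun i j k x y z hx hy hz => ?_⟩
  have hxy := hP.mem_evenSkewMaps hx hy
  have hyz := hP.mem_evenSkewMaps hy hz
  have hzx := hP.mem_evenSkewMaps hz hx
  have h₁ := (a.skew hz hxy.1)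
  have h₂ := (hP.mem_evenSkewMaps (a.bracket_mem hy hz) hx).2
  have h₃ := (hP.mem_evenSkewMaps (a.bracket_mem hz hx) hy).2
  have h₄ := a.skew hz hx
  simp only [spencer₂, negBracket, LinearMap.domRestrict₁₂_apply]
  rw [hP.apply_bracket_eq hx hy, h₁, h₂, h₃, h₄, hzx.2]
  rcases (by decide : ∀ e : ZMod 2, e = 0 ∨ e = 1) i with rfl | rfl <;>
  rcases (by decide : ∀ e : ZMod 2, e = 0 ∨ e = 1) j with rfl | rfl <;>
  rcases (by decide : ∀ e : ZMod 2, e = 0 ∨ e = 1) k with rfl | rfl <;>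
  · simp only [add_zero, zero_add, show (1 + 1 : ZMod 2) = 0 from rfl, superSign_zero_left,
      superSign_zero_right, superSign_one_one, map_neg, map_smul]
    module

theorem act₂_domRestrict_mem_coboundaries₂ {d : ℤ} (hd : P ∈ bilinOfDegree a.deg d)
    (A : ↥(a.deg 0)) : a.act₂ A (P.domRestrict₁₂ a.neg a.neg) ∈ a.coboundaries₂ d := by
  refine ⟨(P A).domRestrict a.neg, fun i x hx => ?_, fun i j x y hx hy => ?_⟩
  · simpa using hd A.2 hx
  · have hA := a.mem_part_zero A.2
    have hPAx : P A x ∈ a.part i := by simpa using (hP.mem_evenSkewMaps hA hx).1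
    have h : P (a.bracket A x) y = _ := hP.apply_bracket_eq hA hx y
    change a.bracket A (P x y) - P (a.bracket A x) y - P x (a.bracket A y) =
      a.bracket x (P A y) - superSign i j • a.bracket y (P A x) - P A (a.bracket x y)
    rw [h, superSign_zero_left, a.skew hPAx hy]
    module

theorem isInvariantClass_cohClass {d : ℤ} (hd : P ∈ bilinOfDegree a.deg d) :
    a.IsInvariantClass d
      (a.cohClass d ⟨P.domRestrict₁₂ a.neg a.neg, hP.domRestrict_mem_cocycles₂ hd⟩) :=
  fun A => (Submodule.Quotient.mk_eq_zero _).2 (hP.act₂_domRestrict_mem_coboundaries₂ hd A)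

end IsCocycle

/-! ### Cocycles of transitive superalgebras -/

variable (a) in
/-- Transitivity: an element of degree `0` is determined by its action on the component of
degree `-1`. -/
def IsTransitive : Prop :=
  ∀ A ∈ a.deg 0, (∀ s ∈ a.deg (-1), a.bracket A s = 0) → A = 0

namespace IsCocycle

variable {P : K →ₗ[ℝ] K →ₗ[ℝ] K} (hP : a.IsCocycle P)
  (hs : a.SupportedIn (Set.Icc (-2) 0)) (ht : a.IsTransitive)

include hP

theorem apply_right_eq_zero {i j : ℤ} (h : ∀ s ∈ a.deg i, P s = 0) {x y : K}
    (hx : x ∈ a.deg j) (hy : y ∈ a.deg i) : P x y = 0 := by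
  rw [(hP.mem_evenSkewMaps (a.deg_le_part j hx) (a.deg_le_part i hy)).2, h y hy,
    LinearMap.zero_apply, smul_zero, neg_zero]

include hs in
/-- All terms of the cocycle identity for `x`, `y` and `s` of degree `-1` vanish, except
`[P(x, y), s]`. -/
theorem bracket_apply_eq_zero (h : ∀ s ∈ a.deg (-1), P s = 0) {i j : ℤ} (hi : i ≠ -1)
    (hj : j ≠ -1) {x y s : K} (hx : x ∈ a.deg i) (hy : y ∈ a.deg j) (hs' : s ∈ a.deg (-1)) :
    a.bracket (P x y) s = 0 := by
  have hright : ∀ {k : ℤ} {z : K}, z ∈ a.deg k → P z s = 0 := fun hz =>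
    hP.apply_right_eq_zero h hz hs'
  have hbracket : ∀ {k m : ℤ} {z w : K}, k ≠ -1 → z ∈ a.deg k → w ∈ a.deg m →
      P w (a.bracket z s) = 0 := by
    intro k m z w hk hz hw
    have hzs := a.deg_bracket_mem hz hs'
    rcases lt_trichotomy k 0 with hk' | rfl | hk'
    · rw [hs.eq_zero (by simp only [Set.mem_Icc]; omega) hzs, map_zero]
    · exact hP.apply_right_eq_zero h hw (by simpa using hzs)
    · rw [hs.eq_zero (by simp [hk']) hz, map_zero, LinearMap.zero_apply, map_zero]
  have hxys := hP.apply_bracket_eq (a.deg_le_part i hx) (a.deg_le_part j hy) s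
  rw [hright (a.deg_bracket_mem hx hy), hright hx, hright hy, hbracket hj hy hx,
    hbracket hi hx hy] at hxys
  simpa using hxys

include hs ht

theorem apply_eq_zero_of_mem_deg_zero (h : ∀ s ∈ a.deg (-1), P s = 0) {i j : ℤ} {x y : K}
    (hx : x ∈ a.deg i) (hy : y ∈ a.deg j) (hxy : P x y ∈ a.deg 0) : P x y = 0 := by
  rcases eq_or_ne i (-1) with rfl | hi
  · rw [h x hx, LinearMap.zero_apply]
  rcases eq_or_ne j (-1) with rfl | hj
  · exact hP.apply_right_eq_zero h hx hy
  exact ht _ hxy fun s hs' => hP.bracket_apply_eq_zero hs h hi hj hx hy hs'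

theorem eq_zero_of_apply_eq_zero {d : ℤ} (hPd : P ∈ bilinOfDegree a.deg d)
    (hodd : ∀ j ∈ Set.Icc (-2) 0, ∀ s ∈ a.deg (-1), ∀ y ∈ a.deg j, P s y = 0)
    (hneg : ∀ i ∈ Set.Icc (-2) 0, ∀ j ∈ Set.Icc (-2) 0, i + j + d < 0 →
      ∀ x ∈ a.deg i, ∀ y ∈ a.deg j, P x y = 0) : P = 0 := by
  have hodd' : ∀ s ∈ a.deg (-1), P s = 0 := fun s hs' =>
    hs.linearMap_ext fun hj y hy => hodd _ hj s hs' y hy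
  refine hs.linearMap_ext fun {i} hi x hx => hs.linearMap_ext fun {j} hj y hy => ?_
  rcases lt_trichotomy (i + j + d) 0 with hd | hd | hd
  · exact hneg i hi j hj hd x hx y hy
  · exact hP.apply_eq_zero_of_mem_deg_zero hs ht hodd' hx hy (hd ▸ hPd hx hy)
  · exact hs.eq_zero (by simp [hd]) (hPd hx hy)

theorem eq_zero_of_domRestrict_eq_zero {d : ℤ} (hd : 2 ≤ d) (hPd : P ∈ bilinOfDegree a.deg d)
    (hneg : P.domRestrict₁₂ a.neg a.neg = 0) : P = 0 := by
  have hneg' : ∀ {i j : ℤ} {x y : K}, i < 0 → j < 0 → x ∈ a.deg i → y ∈ a.deg j → P x y = 0 :=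
    fun hi hj hx hy => LinearMap.congr_fun₂ hneg ⟨_, a.deg_le_neg hi hx⟩ ⟨_, a.deg_le_neg hj hy⟩
  refine hP.eq_zero_of_apply_eq_zero hs ht hPd (fun j hj s hs' y hy => ?_)
    fun i hi j hj hij x hx y hy => ?_
  · rcases hj.2.lt_or_eq with hj | rfl
    · exact hneg' (by norm_num) hj hs' hy
    · exact hs.eq_zero (by simp only [Set.mem_Icc]; omega) (hPd hs' hy)
  · rw [Set.mem_Icc] at hi hj
    exact hneg' (by omega) (by omega) hx hy

theorem eq_zero_of_four_le {d : ℤ} (hd : 4 ≤ d) (hPd : P ∈ bilinOfDegree a.deg d) : P = 0 := by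
  refine hP.eq_zero_of_apply_eq_zero hs ht hPd (fun j hj s hs' y hy => ?_)
    fun i hi j hj hij => ?_
  · exact hs.eq_zero (by simp only [Set.mem_Icc] at hj ⊢; omega) (hPd hs' hy)
  · rw [Set.mem_Icc] at hi hj
    omega

end IsCocycle

/-- By transitivity there is no nonzero cocycle of degree at least `4`, and one of degree `2`
is determined by its restriction to the negative part; hence so is the whole bracket. -/
theorem IsDeformation.eq_of_domRestrict_bilinComponent_eq (hs : a.SupportedIn (Set.Icc (-2) 0))
    (ht : a.IsTransitive) {B B' : K →ₗ[ℝ] K →ₗ[ℝ] K} (hB : a.IsDeformation B)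
    (hB' : a.IsDeformation B')
    (h : (a.bilinComponent 2 B).domRestrict₁₂ a.neg a.neg =
      (a.bilinComponent 2 B').domRestrict₁₂ a.neg a.neg) : B = B' := by
  have hdeg : ∀ d : ℤ, 1 ≤ d → B - B' ∈ bilinOfDegree a.filt d := by
    refine Int.leInduction ?_ fun d hd hmem => a.mem_bilinOfDegree_filt_succ_iff.2 ⟨hmem, ?_⟩
    · simpa using sub_mem hB.sub_bracket_mem hB'.sub_bracket_mem
    have hcocycle := isCocycle_bilinComponent_sub hB' hB hmem
    have hmem' := a.bilinComponent_mem d (B - B')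
    rcases Int.even_or_odd d with heven | hodd
    swap
    · exact a.bilinComponent_eq_zero_of_odd hodd
        (sub_mem hB.mem_evenSkewMaps hB'.mem_evenSkewMaps)
    rcases eq_or_ne d 2 with rfl | hd2
    · refine hcocycle.eq_zero_of_domRestrict_eq_zero hs ht le_rfl hmem' ?_
      rw [bilinComponent_sub]
      exact LinearMap.ext₂ fun x y => sub_eq_zero.2 (LinearMap.congr_fun₂ h x y)
    · refine hcocycle.eq_zero_of_four_le hs ht ?_ hmem'
      obtain ⟨k, rfl⟩ := heven
      omega
  refine a.bilin_ext_deg fun {i j x y} hx hy => sub_eq_zero.1 ?_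
  refine a.eq_zero_of_forall_mem_filt fun k => ?_
  exact a.filt_antitone (by linarith [le_max_right 1 (k - i - j)])
    (a.mem_bilinOfDegree_filt_iff.1 (hdeg (max 1 (k - i - j)) (le_max_left _ _)) hx hy)

end GradedLieSuperalgebra

/-! ### Adapted identifications -/

namespace GrIso

variable {L K : Type*} [AddCommGroup L] [Module ℝ L] [AddCommGroup K] [Module ℝ K]
  {g : FilteredLieSuperalgebra L} {a : GradedLieSuperalgebra K} (φ : GrIso g a)

/-- The symbol of an element of `g.filt i`: the element of `a` of degree `i` that corresponds
to its class in `g.filt i / g.filt (i + 1)`. -/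
def symbol (i : ℤ) : ↥(g.filt i) →ₗ[ℝ] K :=
  (a.deg i).subtype ∘ₗ (φ.equiv i).toLinearMap ∘ₗ g.grMk i

theorem symbol_mem (i : ℤ) (x : ↥(g.filt i)) : φ.symbol i x ∈ a.deg i := Subtype.prop _

theorem symbol_eq_zero_iff {i : ℤ} {x : ↥(g.filt i)} :
    φ.symbol i x = 0 ↔ (x : L) ∈ g.filt (i + 1) := by
  have h : φ.symbol i x = (φ.equiv i (g.grMk i x) : K) := rfl
  rw [h, Submodule.coe_eq_zero, LinearEquiv.map_eq_zero_iff]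
  exact Submodule.Quotient.mk_eq_zero _

theorem symbol_bracket {i j : ℤ} (x : ↥(g.filt i)) (y : ↥(g.filt j)) :
    φ.symbol (i + j) ⟨g.bracket x y, g.filt_bracket_mem x.2 y.2⟩ =
      a.bracket (φ.symbol i x) (φ.symbol j y) :=
  φ.map_bracket i j (g.grMk i x) (g.grMk j y)

include φ in
theorem eq_zero_of_mem_filt {n : ℤ} (hn : a.SupportedIn (Set.Iic n)) {x : L}
    (hx : x ∈ g.filt (n + 1)) : x = 0 := by
  refine g.filt_separated x fun i => ?_
  rcases le_total i (n + 1) with hi | hi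
  · exact g.filt_antitone hi hx
  · induction i, hi using Int.leInduction with
    | base => exact hx
    | succ i hi ih =>
      exact φ.symbol_eq_zero_iff.1 (hn.eq_zero (by simpa using hi) (φ.symbol_mem i ⟨x, ih⟩))

/-- The linear maps `a → g` that are compatible with parities and filtrations and induce the
inverse of `φ` on the associated graded spaces. -/
structure IsAdapted (T : K →ₗ[ℝ] L) : Prop where
  mem_part : ∀ {i : ℤ} {x : K}, x ∈ a.deg i → T x ∈ g.part (i : ZMod 2)
  mem_filt : ∀ {i : ℤ} {x : K}, x ∈ a.deg i → T x ∈ g.filt i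
  symbol_apply : ∀ {i : ℤ} {x : K} (hx : x ∈ a.deg i), φ.symbol i ⟨T x, mem_filt hx⟩ = x

theorem exists_homogeneous_lift (i : ℤ) : ∃ s : ↥(a.deg i) →ₗ[ℝ] ↥(g.filt i),
    ∀ x, (s x : L) ∈ g.part (i : ZMod 2) ∧ φ.symbol i (s x) = x := by
  let p : Submodule ℝ ↥(g.filt i) := (g.part (i : ZMod 2)).submoduleOf (g.filt i)
  let f : ↥p →ₗ[ℝ] ↥(a.deg i) := (φ.equiv i).toLinearMap ∘ₗ g.grMk i ∘ₗ p.subtype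
  have hf : LinearMap.range f = ⊤ := by
    refine LinearMap.range_eq_top.2 fun y => ?_
    have hy : (φ.equiv i).symm y ∈ g.grPart i (i : ZMod 2) := by
      rw [φ.map_part, LinearEquiv.apply_symm_apply]
      exact a.deg_le_part i y.2
    obtain ⟨z, hz, hzy⟩ := hy
    exact ⟨⟨z, hz⟩, (φ.equiv i).eq_symm_apply.1 hzy⟩
  obtain ⟨s, hs⟩ := f.exists_rightInverse_of_surjective hf
  exact ⟨p.subtype ∘ₗ s, fun x =>
    ⟨(s x).2, congrArg Subtype.val (LinearMap.congr_fun hs x)⟩⟩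

theorem exists_isAdapted : ∃ T : K →ₗ[ℝ] L, φ.IsAdapted T := by
  choose s hs using φ.exists_homogeneous_lift
  let T : K →ₗ[ℝ] L :=
    DirectSum.toModule ℝ ℤ L (fun i => (g.filt i).subtype ∘ₗ s i) ∘ₗ a.decomp.toLinearMap
  have hT : ∀ {i : ℤ} {x : K} (hx : x ∈ a.deg i), T x = s i ⟨x, hx⟩ := fun hx => by
    simp [T, a.decomp_of_mem hx]
  refine ⟨T, fun {i x} hx => ?_, fun {i x} hx => ?_, fun {i x} hx => ?_⟩
  · exact hT hx ▸ (hs i ⟨x, hx⟩).1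
  · exact hT hx ▸ (s i ⟨x, hx⟩).2
  · simpa only [hT hx] using (hs i ⟨x, hx⟩).2

namespace IsAdapted

variable {φ} {T : K →ₗ[ℝ] L} (hT : φ.IsAdapted T)

include hT

theorem map_part {e : ZMod 2} {x : K} (hx : x ∈ a.part e) : T x ∈ g.part e := by
  rw [a.part_eq_iSup_deg] at hx
  have hle : ⨆ i : {i : ℤ // (i : ZMod 2) = e}, a.deg i ≤ (g.part e).comap T :=
    iSup_le fun i _ hy => Submodule.mem_comap.2 (i.2 ▸ hT.mem_part hy)
  exact hle hx

theorem map_filt {i : ℤ} {x : K} (hx : x ∈ a.filt i) : T x ∈ g.filt i :=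
  (iSup_le fun j _ hy => g.filt_antitone j.2 (hT.mem_filt hy) :
    a.filt i ≤ (g.filt i).comap T) hx

theorem symbol_apply_of_mem_filt {i : ℤ} {x : K} (hx : x ∈ a.filt i) :
    φ.symbol i ⟨T x, hT.map_filt hx⟩ = a.proj i x := by
  have hproj := a.proj_mem i x
  have hdiff : x - a.proj i x ∈ a.filt (i + 1) := a.mem_filt_succ_iff.2
    ⟨sub_mem hx (a.deg_le_filt le_rfl hproj), by rw [map_sub, a.proj_of_mem hproj, sub_self]⟩
  conv_rhs => rw [← hT.symbol_apply hproj]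
  rw [← sub_eq_zero, ← map_sub, symbol_eq_zero_iff]
  simpa using hT.map_filt hdiff

theorem mem_filt_iff {i : ℤ} {x : K} : T x ∈ g.filt i ↔ x ∈ a.filt i := by
  refine ⟨fun hTx => ?_, hT.map_filt⟩
  obtain ⟨k, hk⟩ := a.exists_mem_filt x
  rcases le_total i k with hik | hki
  · exact a.filt_antitone hik hk
  induction i, hki using Int.leInduction with
  | base => exact hk
  | succ i _ ih =>
    have hx := ih (g.filt_antitone (by linarith) hTx)
    refine a.mem_filt_succ_iff.2 ⟨hx, ?_⟩
    rw [← hT.symbol_apply_of_mem_filt hx, symbol_eq_zero_iff]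
    exact hTx

theorem injective : Function.Injective T :=
  (injective_iff_map_eq_zero T).2 fun _ hx => a.eq_zero_of_forall_mem_filt fun _ =>
    hT.mem_filt_iff.1 (hx ▸ zero_mem _)

theorem exists_sub_mem_filt {i k : ℤ} (hik : i ≤ k) {y : L} (hy : y ∈ g.filt i) :
    ∃ x, y - T x ∈ g.filt k := by
  induction k, hik using Int.leInduction with
  | base => exact ⟨0, by simpa using hy⟩
  | succ k _ ih =>
    obtain ⟨x, hx⟩ := ih
    set z := φ.symbol k ⟨y - T x, hx⟩
    have hz : z ∈ a.deg k := φ.symbol_mem k _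
    refine ⟨x + z, ?_⟩
    rw [map_add, ← sub_sub]
    have hsymbol : φ.symbol k (⟨y - T x, hx⟩ - ⟨T z, hT.mem_filt hz⟩) = 0 := by
      rw [map_sub, hT.symbol_apply hz, sub_self]
    exact φ.symbol_eq_zero_iff.1 hsymbol

theorem surjective {n : ℤ} (hn : a.SupportedIn (Set.Iic n)) : Function.Surjective T := fun y => by
  obtain ⟨i, hi⟩ := g.filt_exhaustive y
  obtain ⟨x, hx⟩ := hT.exists_sub_mem_filt (le_max_left i (n + 1)) hi
  exact ⟨x, (sub_eq_zero.1
    (φ.eq_zero_of_mem_filt hn (g.filt_antitone (le_max_right _ _) hx))).symm⟩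

/-- The adapted identification underlying an adapted linear map. -/
def toSplitting {n : ℤ} (hn : a.SupportedIn (Set.Iic n)) : Splitting φ where
  equiv := LinearEquiv.ofBijective T ⟨hT.injective, hT.surjective hn⟩
  map_part _ _ := hT.map_part
  map_deg _ _ := hT.mem_filt
  symbol _ _ := hT.symbol_apply

end IsAdapted

theorem nonempty_splitting {n : ℤ} (hn : a.SupportedIn (Set.Iic n)) : Nonempty (Splitting φ) :=
  let ⟨_, hT⟩ := φ.exists_isAdapted
  ⟨hT.toSplitting hn⟩

end GrIso

namespace Splitting

variable {L K : Type*} [AddCommGroup L] [Module ℝ L] [AddCommGroup K] [Module ℝ K]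
  {g : FilteredLieSuperalgebra L} {a : GradedLieSuperalgebra K} {φ : GrIso g a}
  (Θ : Splitting φ)

theorem isAdapted : φ.IsAdapted Θ.equiv.toLinearMap where
  mem_part hx := Θ.map_part _ _ (a.deg_le_part _ hx)
  mem_filt := Θ.map_deg _ _
  symbol_apply := Θ.symbol _ _

theorem mem_part_iff {e : ZMod 2} {x : K} : Θ.equiv x ∈ g.part e ↔ x ∈ a.part e :=
  g.mem_part_iff_of_map_part a.toLieSuperalgebra Θ.equiv Θ.map_part

theorem equiv_bracket (x y : K) : Θ.equiv (Θ.bracket x y) = g.bracket (Θ.equiv x) (Θ.equiv y) :=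
  Θ.equiv.apply_symm_apply _

theorem bracket_mem_filt {i j : ℤ} {x y : K} (hx : x ∈ a.deg i) (hy : y ∈ a.deg j) :
    Θ.bracket x y ∈ a.filt (i + j) := by
  refine Θ.isAdapted.mem_filt_iff.1 ?_
  exact (Θ.equiv_bracket x y).symm ▸ g.filt_bracket_mem (Θ.map_deg i x hx) (Θ.map_deg j y hy)

theorem proj_bracket {i j : ℤ} {x y : K} (hx : x ∈ a.deg i) (hy : y ∈ a.deg j) :
    a.proj (i + j) (Θ.bracket x y) = a.bracket x y := by
  have hsymbol := φ.symbol_bracket ⟨_, Θ.map_deg i x hx⟩ ⟨_, Θ.map_deg j y hy⟩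
  rw [← Θ.isAdapted.symbol_apply_of_mem_filt (Θ.bracket_mem_filt hx hy)]
  simp only [LinearEquiv.coe_coe, equiv_bracket]
  rw [hsymbol]
  exact congrArg₂ (a.bracket · ·) (Θ.symbol i x hx) (Θ.symbol j y hy)

theorem isDeformation_bracket : a.IsDeformation Θ.bracket where
  mem_evenSkewMaps i j x y hx hy := by
    have hx' := Θ.map_part i x hx
    have hy' := Θ.map_part j y hy
    refine ⟨Θ.mem_part_iff.1 ?_, Θ.equiv.injective ?_⟩
    · exact (Θ.equiv_bracket x y).symm ▸ g.bracket_mem hx' hy'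
    · rw [map_neg, map_smul, equiv_bracket, equiv_bracket, g.skew hx' hy']
  jacobiator_self {i j x y} hx hy := by
    refine LinearMap.ext fun z => Θ.equiv.injective ?_
    have hjac := LinearMap.congr_fun
      (g.jacobiator_bracket (Θ.map_part i x hx) (Θ.map_part j y hy)) (Θ.equiv z)
    rw [jacobiator_apply] at hjac
    simpa only [jacobiator_apply, map_sub, map_smul, equiv_bracket, LinearMap.zero_apply,
      map_zero] using hjac
  sub_bracket_mem := a.mem_bilinOfDegree_filt_iff.2 fun {i j x y} hx hy => by
    have hb := a.deg_bracket_mem hx hy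
    refine a.mem_filt_succ_iff.2
      ⟨sub_mem (Θ.bracket_mem_filt hx hy) (a.deg_le_filt le_rfl hb), ?_⟩
    rw [LinearMap.sub_apply, LinearMap.sub_apply, map_sub, Θ.proj_bracket hx hy,
      a.proj_of_mem hb, sub_self]

/-- The difference with the bracket of `a` has no component of degree `1`, which would be odd, so
its leading term has degree `2`. -/
theorem isCocycle_bilinComponent_two : a.IsCocycle (a.bilinComponent 2 Θ.bracket) := by
  have hB := Θ.isDeformation_bracket
  have hmem : Θ.bracket - a.bracket ∈ bilinOfDegree a.filt (1 + 1) :=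
    a.mem_bilinOfDegree_filt_succ_iff.2 ⟨hB.sub_bracket_mem, a.bilinComponent_eq_zero_of_odd
      odd_one (sub_mem hB.mem_evenSkewMaps a.bracket_mem_evenSkewMaps)⟩
  have hbracket : a.bilinComponent 2 a.bracket = 0 := a.bilin_ext_deg fun {i j x y} hx hy => by
    rw [a.bilinComponent_apply 2 _ hx hy,
      a.proj_of_mem_ne (by linarith) (a.deg_bracket_mem hx hy)]
    rfl
  have hcocycle :=
    GradedLieSuperalgebra.isCocycle_bilinComponent_sub a.isDeformation_bracket hB hmem
  rwa [one_add_one_eq_two, a.bilinComponent_sub, hbracket, sub_zero] at hcocycle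

theorem mu_mem_cocycles₂ : Θ.mu ∈ a.cocycles₂ 2 :=
  Θ.isCocycle_bilinComponent_two.domRestrict_mem_cocycles₂ (a.bilinComponent_mem 2 _)

theorem isInvariantClass_mu : a.IsInvariantClass 2 (a.cohClass 2 ⟨Θ.mu, Θ.mu_mem_cocycles₂⟩) :=
  Θ.isCocycle_bilinComponent_two.isInvariantClass_cohClass (a.bilinComponent_mem 2 _)

end Splitting

/-! ### Change of the adapted identification -/

namespace GradedLieSuperalgebra

variable {K : Type*} [AddCommGroup K] [Module ℝ K] (a : GradedLieSuperalgebra K)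

/-- The Chevalley–Eilenberg differential of an even linear map `f`, as a `1`-cochain of `a` with
values in the adjoint representation; the sign of the second term is absorbed by
skew-symmetry. -/
def adCoboundary (f : K →ₗ[ℝ] K) : K →ₗ[ℝ] K →ₗ[ℝ] K :=
  a.bracket ∘ₗ f + a.bracket.compl₂ f - a.bracket.compr₂ f

theorem adCoboundary_apply (f : K →ₗ[ℝ] K) (x y : K) :
    a.adCoboundary f x y = a.bracket (f x) y + a.bracket x (f y) - f (a.bracket x y) := rfl

theorem linearMap_ext_neg {M : Type*} [AddCommGroup M] [Module ℝ M] {f g : ↥a.neg →ₗ[ℝ] M}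
    (h : ∀ {i : ℤ} (hi : i < 0) {x : K} (hx : x ∈ a.deg i),
      f ⟨x, a.deg_le_neg hi hx⟩ = g ⟨x, a.deg_le_neg hi hx⟩) : f = g := by
  refine LinearMap.ext fun ⟨x, hx⟩ => ?_
  refine Submodule.iSup_induction' (fun i : {i : ℤ // i < 0} => a.deg i)
    (motive := fun x hx => f ⟨x, hx⟩ = g ⟨x, hx⟩) (fun i x hx => h i.2 hx) ?_ ?_ hx
  · exact (map_zero f).trans (map_zero g).symm
  · intro x y hx hy hfx hfy
    have hadd : (⟨x + y, add_mem hx hy⟩ : ↥a.neg) = ⟨x, hx⟩ + ⟨y, hy⟩ := rfl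
    rw [hadd, map_add, map_add, hfx, hfy]

variable {a} {d : ℤ}

theorem exists_extension {ψ : ↥a.neg →ₗ[ℝ] K} (hψ : ψ ∈ a.cochains₁ d) :
    ∃ f : K →ₗ[ℝ] K, (∀ i, ∀ x ∈ a.deg i, f x ∈ a.deg (i + d)) ∧ f.domRestrict a.neg = ψ := by
  let f : K →ₗ[ℝ] K := DirectSum.toModule ℝ ℤ K (fun i =>
    if h : i < 0 then ψ ∘ₗ Submodule.inclusion (a.deg_le_neg h) else 0) ∘ₗ a.decomp.toLinearMap
  have hf : ∀ {i : ℤ} (hi : i < 0) {x : K} (hx : x ∈ a.deg i),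
      f x = ψ ⟨x, a.deg_le_neg hi hx⟩ := fun hi x hx => by
    simp [f, a.decomp_of_mem hx, hi, Submodule.inclusion_apply]
  refine ⟨f, fun i x hx => ?_, a.linearMap_ext_neg fun hi x hx => hf hi hx⟩
  by_cases hi : i < 0
  · exact hf hi hx ▸ hψ i ⟨x, a.deg_le_neg hi hx⟩ hx
  · simp [f, a.decomp_of_mem hx, hi]

variable {f : K →ₗ[ℝ] K} (hf : ∀ i, ∀ x ∈ a.deg i, f x ∈ a.deg (i + d))

include hf

theorem map_mem_part_of_even (hd : Even d) {e : ZMod 2} {x : K} (hx : x ∈ a.part e) :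
    f x ∈ a.part e := by
  have hle : ⨆ i : {i : ℤ // (i : ZMod 2) = e}, a.deg i ≤ (a.part e).comap f := by
    refine iSup_le fun i x hx => ?_
    have hfx := a.deg_le_part _ (hf i x hx)
    rwa [Int.cast_add, (ZMod.intCast_eq_zero_iff_even).2 hd, add_zero, i.2] at hfx
  rw [part_eq_iSup_deg] at hx
  exact hle hx

theorem map_mem_filt {i : ℤ} {x : K} (hx : x ∈ a.filt i) : f x ∈ a.filt (i + d) := by
  have hle : a.filt i ≤ (a.filt (i + d)).comap f :=
    iSup_le fun j x hx => a.deg_le_filt (by linarith [j.2]) (hf j x hx)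
  exact hle hx

theorem adCoboundary_mem_bilinOfDegree : a.adCoboundary f ∈ bilinOfDegree a.deg d := by
  intro i j x y hx hy
  have hfx := a.deg_bracket_mem (hf i x hx) hy
  have hfy := a.deg_bracket_mem hx (hf j y hy)
  rw [add_right_comm] at hfx
  rw [← add_assoc] at hfy
  exact sub_mem (add_mem hfx hfy) (hf _ _ (a.deg_bracket_mem hx hy))

theorem adCoboundary_eq_spencer₁ (hd : Even d) {i j : ZMod 2} {x y : ↥a.neg}
    (hx : (x : K) ∈ a.part i) (hy : (y : K) ∈ a.part j) :
    a.adCoboundary f x y = a.spencer₁ (f.domRestrict a.neg) i j x y := by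
  rw [adCoboundary_apply, a.skew (map_mem_part_of_even hf hd hx) hy]
  change _ = a.bracket x (f y) - superSign i j • a.bracket y (f x) - f (a.bracket x y)
  abel

end GradedLieSuperalgebra

namespace Splitting

variable {L K : Type*} [AddCommGroup L] [Module ℝ L] [AddCommGroup K] [Module ℝ K]
  {g : FilteredLieSuperalgebra L} {a : GradedLieSuperalgebra K} {φ : GrIso g a}
  (Θ : Splitting φ) {d : ℤ} {f : K →ₗ[ℝ] K}

theorem isAdapted_comp_id_add (hd : Even d) (hd₀ : 0 < d)
    (hf : ∀ i, ∀ x ∈ a.deg i, f x ∈ a.deg (i + d)) :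
    φ.IsAdapted (Θ.equiv.toLinearMap ∘ₗ (LinearMap.id + f)) := by
  have hfilt : ∀ {i : ℤ} {x : K}, x ∈ a.deg i → x + f x ∈ a.filt i := fun {i x} hx =>
    add_mem (a.deg_le_filt le_rfl hx) (a.deg_le_filt (by linarith) (hf i x hx))
  refine ⟨fun {i x} hx => Θ.map_part _ _ ?_, fun hx => Θ.isAdapted.map_filt (hfilt hx),
    fun {i x} hx => (Θ.isAdapted.symbol_apply_of_mem_filt (hfilt hx)).trans ?_⟩
  · have hx' := a.deg_le_part i hx
    exact add_mem hx' (GradedLieSuperalgebra.map_mem_part_of_even hf hd hx')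
  · rw [map_add, a.proj_of_mem hx, a.proj_of_mem_ne (by linarith) (hf i x hx), add_zero]

theorem bilinComponent_eq_add_adCoboundary {Θ' : Splitting φ} (hd₀ : 0 < d)
    (hf : ∀ i, ∀ x ∈ a.deg i, f x ∈ a.deg (i + d))
    (hΘ' : ∀ x, Θ'.equiv x = Θ.equiv (x + f x)) :
    a.bilinComponent d Θ'.bracket = a.bilinComponent d Θ.bracket + a.adCoboundary f := by
  set B := Θ.bracket
  set B' := Θ'.bracket
  have hB := Θ.isDeformation_bracket
  have hB' := Θ'.isDeformation_bracket
  have hbracket : ∀ x y, B' x y + f (B' x y) = B (x + f x) (y + f y) := fun x y =>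
    Θ.equiv.injective (by rw [← hΘ', equiv_bracket, equiv_bracket, hΘ', hΘ'])
  have hdiff : ∀ x y, (B' - B - a.adCoboundary f) x y = (B - a.bracket) (f x) y +
      (B - a.bracket) x (f y) + B (f x) (f y) - f ((B' - a.bracket) x y) := fun x y => by
    have hxy := hbracket x y
    simp only [LinearMap.sub_apply, a.adCoboundary_apply, map_add, map_sub, LinearMap.add_apply]
      at hxy ⊢
    linear_combination (norm := module) hxy
  have hmem : B' - B - a.adCoboundary f ∈ bilinOfDegree a.filt (d + 1) := by
    intro i j x y hx hy
    have hfx := GradedLieSuperalgebra.map_mem_filt hf hx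
    have hfy := GradedLieSuperalgebra.map_mem_filt hf hy
    have hle : ∀ {k}, i + j + (d + 1) ≤ k → a.filt k ≤ a.filt (i + j + (d + 1)) :=
      fun hk => a.filt_antitone hk
    rw [hdiff]
    refine sub_mem (add_mem (add_mem ?_ ?_) ?_) ?_
    · exact hle (by linarith) (hB.sub_bracket_mem hfx hy)
    · exact hle (by linarith) (hB.sub_bracket_mem hx hfy)
    · exact hle (by linarith) (hB.mem_bilinOfDegree_filt hfx hfy)
    · exact hle (by linarith)
        (GradedLieSuperalgebra.map_mem_filt hf (hB'.sub_bracket_mem hx hy))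
  have hcomp := (a.mem_bilinOfDegree_filt_succ_iff.1 hmem).2
  rw [a.bilinComponent_sub, a.bilinComponent_sub, a.bilinComponent_of_mem
    (GradedLieSuperalgebra.adCoboundary_mem_bilinOfDegree hf)] at hcomp
  exact eq_add_of_sub_eq' (sub_eq_zero.1 hcomp)

theorem exists_mu_eq_add {n : ℤ} (hn : a.SupportedIn (Set.Iic n))
    {ζ : ↥a.neg →ₗ[ℝ] ↥a.neg →ₗ[ℝ] K} (hζ : ζ ∈ a.coboundaries₂ 2) :
    ∃ Θ' : Splitting φ, Θ'.mu = Θ.mu + ζ := by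
  obtain ⟨ψ, hψ, hζψ⟩ := hζ
  obtain ⟨f, hf, rfl⟩ := GradedLieSuperalgebra.exists_extension hψ
  let Θ' := (Θ.isAdapted_comp_id_add even_two two_pos hf).toSplitting hn
  have hcomp := Θ.bilinComponent_eq_add_adCoboundary (Θ' := Θ') two_pos hf fun _ => rfl
  refine ⟨Θ', a.linearMap_ext_neg fun {i} hi x hx => a.linearMap_ext_neg fun {j} hj y hy => ?_⟩
  rw [LinearMap.add_apply, LinearMap.add_apply,
    hζψ i j _ _ (a.deg_le_part i hx) (a.deg_le_part j hy),
    ← GradedLieSuperalgebra.adCoboundary_eq_spencer₁ hf even_two (a.deg_le_part i hx)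
      (a.deg_le_part j hy)]
  exact LinearMap.congr_fun₂ hcomp x y

variable {L' : Type*} [AddCommGroup L'] [Module ℝ L'] {g' : FilteredLieSuperalgebra L'}
  {φ' : GrIso g' a}

/-- The isomorphism of two filtered deformations that induce the same bracket on `a`. -/
def filteredIso (Θ : Splitting φ) (Θ' : Splitting φ') (h : Θ'.bracket = Θ.bracket) :
    FilteredIso g' g where
  equiv := Θ'.equiv.symm.trans Θ.equiv
  map_bracket x y := by
    obtain ⟨x, rfl⟩ := Θ'.equiv.surjective x
    obtain ⟨y, rfl⟩ := Θ'.equiv.surjective y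
    simp only [← equiv_bracket, h, LinearEquiv.trans_apply, LinearEquiv.symm_apply_apply]
  map_part e x := by
    obtain ⟨x, rfl⟩ := Θ'.equiv.surjective x
    simp only [mem_part_iff, LinearEquiv.trans_apply, LinearEquiv.symm_apply_apply]
  map_filt i x := by
    obtain ⟨x, rfl⟩ := Θ'.equiv.surjective x
    rw [LinearEquiv.trans_apply, LinearEquiv.symm_apply_apply]
    exact Θ'.isAdapted.mem_filt_iff.trans Θ.isAdapted.mem_filt_iff.symm

theorem nonempty_filteredIso (hs : a.SupportedIn (Set.Icc (-2) 0)) (ht : a.IsTransitive)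
    (Θ : Splitting φ) (Θ' : Splitting φ') (h : Θ'.mu - Θ.mu ∈ a.coboundaries₂ 2) :
    Nonempty (FilteredIso g' g) := by
  obtain ⟨Θ₁, hΘ₁⟩ := Θ.exists_mu_eq_add (hs.mono Set.Icc_subset_Iic_self) h
  rw [add_sub_cancel] at hΘ₁
  exact ⟨filteredIso Θ₁ Θ' (Θ'.isDeformation_bracket.eq_of_domRestrict_bilinComponent_eq hs ht
    Θ₁.isDeformation_bracket hΘ₁.symm)⟩

end Splitting

/-! ### Transitivity of the Poincaré superalgebra -/

section Poincare

variable {V : Type*} [AddCommGroup V] [Module ℝ V] {η : LorentzForm V}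
  {S : Type*} [AddCommGroup S] [Module ℝ S] [Module η.Cl S] [IsScalarTower ℝ η.Cl S]

theorem LorentzForm.eq_zero_of_smul_eq_zero [Nontrivial S] {u : V}
    (hu : ∀ s : S, η.ι u • s = 0) : u = 0 := by
  obtain ⟨s, hs⟩ := exists_ne (0 : S)
  have horth : ∀ w, η.form w u = 0 := fun w => by
    have h := congrArg (· • s) (η.ι_mul_add_swap w u)
    simp only [add_smul, mul_smul, hu, smul_zero, add_zero, smul_assoc, one_smul] at h
    simpa [hs] using h.symm
  rw [← η.sum_basis u]
  simp [horth]

theorem SpinorForm.eq_zero_of_sigma_eq_zero [Nontrivial S] {A : ↥η.so}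
    (hA : ∀ s : S, SpinorForm.sigma η S A s = 0) : A = 0 := by
  refine Subtype.ext (LinearMap.ext fun v => ?_)
  refine LorentzForm.eq_zero_of_smul_eq_zero (η := η) (S := S) fun s => ?_
  have h := SpinorForm.sigma_ι A v s
  rw [hA, hA, smul_zero, zero_add] at h
  exact h.symm

variable {ω : SpinorForm η S} (a : GradedSubalgebra (poincare η ω))

theorem GradedSubalgebra.supportedIn_toGraded : a.toGraded.SupportedIn (Set.Icc (-2) 0) := by
  refine fun i hi => (Submodule.eq_bot_iff _).2 fun x hx => Subtype.ext ?_
  rw [Set.mem_Icc] at hi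
  exact Prod.ext (hx.1 (by omega)) (Prod.ext (hx.2.1 (by omega)) (hx.2.2 (by omega)))

theorem GradedSubalgebra.isTransitive_toGraded [Nontrivial S]
    (hS : (poincare η ω).deg (-1) ≤ a.carrier) : a.toGraded.IsTransitive := by
  rintro ⟨⟨v, s, A⟩, hmem⟩ hdeg hbracket
  obtain rfl : v = 0 := hdeg.1 (by decide)
  obtain rfl : s = 0 := hdeg.2.1 (by decide)
  obtain rfl : A = 0 := by
    refine SpinorForm.eq_zero_of_sigma_eq_zero (S := S) fun t => ?_
    have ht : ((0, t, 0) : V × S × ↥η.so) ∈ (poincare η ω).deg (-1) :=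
      ⟨fun _ => rfl, fun h => absurd rfl h, fun _ => rfl⟩
    have hAt : poincareBracket η ω (0, 0, A) (0, t, 0) = 0 :=
      congrArg Subtype.val (hbracket ⟨(0, t, 0), hS ht⟩ ht)
    rw [bracket_even_odd] at hAt
    exact congrArg (fun p => p.2.1) hAt
  rfl

end Poincare

theorem proposition5p2_general {K : Type*} [AddCommGroup K] [Module ℝ K]
    {a : GradedLieSuperalgebra K} (hs : a.SupportedIn (Set.Icc (-2) 0)) (ht : a.IsTransitive)
    {L : Type*} [AddCommGroup L] [Module ℝ L] (g : FilteredLieSuperalgebra L) (φ : GrIso g a) :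
    Nonempty (Splitting φ) ∧
    (∀ Θ : Splitting φ, ∃ hμ : Θ.mu ∈ a.cocycles₂ 2,
      a.IsInvariantClass 2 (a.cohClass 2 ⟨Θ.mu, hμ⟩)) ∧
    (∀ {L' : Type*} [AddCommGroup L'] [Module ℝ L'] (g' : FilteredLieSuperalgebra L')
      (φ' : GrIso g' a) (Θ : Splitting φ) (Θ' : Splitting φ')
      (hμ : Θ.mu ∈ a.cocycles₂ 2) (hμ' : Θ'.mu ∈ a.cocycles₂ 2),
      a.cohClass 2 ⟨Θ'.mu, hμ'⟩ = a.cohClass 2 ⟨Θ.mu, hμ⟩ → Nonempty (FilteredIso g' g)) :=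
  ⟨φ.nonempty_splitting (hs.mono Set.Icc_subset_Iic_self),
    fun Θ => ⟨Θ.mu_mem_cocycles₂, Θ.isInvariantClass_mu⟩,
    fun _ _ Θ Θ' _ _ h => Splitting.nonempty_filteredIso hs ht Θ Θ'
      ((Submodule.Quotient.eq ((a.coboundaries₂ 2).submoduleOf (a.cocycles₂ 2))).1 h)⟩

end

theorem proposition5p2 {V : Type*} [AddCommGroup V] [Module ℝ V] (η : LorentzForm V)
    {S : Type*} [AddCommGroup S] [Module ℝ S] [Module η.Cl S] [IsScalarTower ℝ η.Cl S]
    [IsSimpleModule η.Cl S] (ω : SpinorForm η S)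
    (a : GradedSubalgebra (poincare η ω))
    (hV : (poincare η ω).deg (-2) ≤ a.carrier) (hS : (poincare η ω).deg (-1) ≤ a.carrier)
    {L : Type*} [AddCommGroup L] [Module ℝ L] (g : FilteredLieSuperalgebra L)
    (φ : GrIso g a.toGraded) :
    Nonempty (Splitting φ) ∧
    (∀ Θ : Splitting φ, ∃ hμ : Θ.mu ∈ a.toGraded.cocycles₂ 2,
      a.toGraded.IsInvariantClass 2 (a.toGraded.cohClass 2 ⟨Θ.mu, hμ⟩)) ∧
    (∀ {L' : Type*} [AddCommGroup L'] [Module ℝ L'] (g' : FilteredLieSuperalgebra L')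
      (φ' : GrIso g' a.toGraded) (Θ : Splitting φ) (Θ' : Splitting φ')
      (hμ : Θ.mu ∈ a.toGraded.cocycles₂ 2) (hμ' : Θ'.mu ∈ a.toGraded.cocycles₂ 2),
      a.toGraded.cohClass 2 ⟨Θ'.mu, hμ'⟩ = a.toGraded.cohClass 2 ⟨Θ.mu, hμ⟩ →
        Nonempty (FilteredIso g' g)) := by
  have : Nontrivial S := IsSimpleModule.nontrivial η.Cl S
  exact proposition5p2_general a.supportedIn_toGraded (a.isTransitive_toGraded hS) g φ
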